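/- Let $H\in(0,1)$ and $\theta>0$. A fractional Brownian motion with Hurst parameter $H$ is a centered Gaussian process $B^H=\{B^H_t,\ t\in\mathbb R\}$ with almost surely continuous paths and $$E\left(B^H_tB^H_s\right)=\tfrac12\left(|t|^{2H}+|s|^{2H}-|t-s|^{2H}\right),\qquad s,t\in\mathbb R.$$ Given such a process, put $$X^H_t=e^{-\theta t}\int_0^t e^{\theta s}\,dB^H_s\quad(t\ge 0),\qquad Z^H_t=\int_{-\infty}^t e^{-\theta(t-s)}\,dB^H_s\quad(t\in\mathbb R),$$ where the integrals are pathwise Riemann–Stieltjes integrals (the second one improper at $-\infty$). Almost surely, these integrals exist for all such $t$, and $X^H_t$ and $Z^H_t$ have finite moments of all orders. Moreover: (i) $Z^H$ is an ergodic stationary Gaussian process. (Ergodic means: every event $\{Z^H\in A\}$, with $A$ in the product $\sigma$-algebra of $\mathbb R^{\mathbb R}$, that is invariant up to null sets under every time shift has probability $0$ or $1$.) (ii) For every integer $p\ge1$ there is a constant $C>0$ depending only on $\theta$, $H$ and $p$ such that: if $p$ is even, then $$\left|E\left[(X^H_t)^p\right]-E\left[(Z^H_0)^p\right]\right|\le Ce^{-\theta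 t}\quad\text{for all }t\ge0,\qquad E\left[(Z^H_0)^p\right]=\frac{p!}{2^{p/2}\,(p/2)!}\left(\frac{H\,\Gamma(2H)}{\theta^{2H}}\right)^{p/2};$$ if $p$ is odd, then $E\left[(X^H_t)^p\right]=E\left[(Z^H_0)^p\right]=0$ for all $t\ge0$. (iii) If $H\ne\frac12$, then $$E\left(Z^H_tZ^H_0\right)\sim \frac{H(2H-1)}{\theta^2}\,t^{2H-2}\quad\text{as }t\to\infty,$$ that is, the ratio of the two sides tends to $1$. If $H=\frac12$, then $E\left(Z^H_tZ^H_0\right)=\frac{e^{-\theta t}}{2\theta}$ for all $t\ge0$. (iv) There is a constant $C>0$ depending only on $\theta$ and $H$ such that, for all $s,t\ge0$ with $|t-s|>2$: if $H\neq\frac12$, then $E\left(X^H_tX^H_s\right)\le C|t-s|^{2H-2}$; if $H=\frac12$, then $E\left(X^H_tX^H_s\right)\le Ce^{-\theta|t-s|}$. -/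

import Mathlib

open MeasureTheory ProbabilityTheory Filter Topology
open scoped Nat

/-- `I` is the Riemann-Stieltjes integral of `f` with respect to `g` over `[a, b]` (`a ≤ b`): the
sums `∑ f (ξ i) * (g (x (i + 1)) - g (x i))` over the tagged partitions
`a = x 0 ≤ ξ 0 ≤ x 1 ≤ ⋯ ≤ x n = b` tend to `I` as the mesh tends to zero. -/
def HasRSIntegral (f g : ℝ → ℝ) (a b I : ℝ) : Prop :=
  a ≤ b ∧ ∀ ε > 0, ∃ δ > 0, ∀ (n : ℕ) (x ξ : ℕ → ℝ), x 0 = a → x n = b →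
    (∀ i < n, x i ≤ ξ i ∧ ξ i ≤ x (i + 1) ∧ x (i + 1) - x i < δ) →
    |∑ i ∈ Finset.range n, f (ξ i) * (g (x (i + 1)) - g (x i)) - I| < ε

open Classical in
/-- The Riemann-Stieltjes integral of `f` with respect to `g` over `[a, b]`
(zero when it does not exist). -/
noncomputable def rsIntegral (f g : ℝ → ℝ) (a b : ℝ) : ℝ :=
  if h : ∃ I, HasRSIntegral f g a b I then h.choose else 0

/-- `I` is the improper Riemann-Stieltjes integral of `f` with respect to `g` over `(-∞, b]`:
the integral over every `[a, b]` exists, and it tends to `I` as `a → -∞`. -/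
def HasRSIntegralIic (f g : ℝ → ℝ) (b I : ℝ) : Prop :=
  (∀ a ≤ b, ∃ J, HasRSIntegral f g a b J) ∧ Tendsto (fun a ↦ rsIntegral f g a b) atBot (𝓝 I)

open Classical in
/-- The improper Riemann-Stieltjes integral of `f` with respect to `g` over `(-∞, b]`
(zero when it does not exist). -/
noncomputable def rsIntegralIic (f g : ℝ → ℝ) (b : ℝ) : ℝ :=
  if h : ∃ I, HasRSIntegralIic f g b I then h.choose else 0

/-- `B`, indexed by `ℝ`, is a fractional Brownian motion with Hurst parameter `H`: a centered
Gaussian process with the covariance of fractional Brownian motion and almost surely continuous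
paths. -/
structure IsFractionalBrownianMotion {Ω : Type*} [MeasurableSpace Ω] (H : ℝ) (B : ℝ → Ω → ℝ)
    (P : Measure Ω) : Prop where
  isGaussianProcess : IsGaussianProcess B P
  centered : ∀ t, ∫ ω, B t ω ∂P = 0
  covariance : ∀ t s, ∫ ω, B t ω * B s ω ∂P =
    1 / 2 * (|t| ^ (2 * H) + |s| ^ (2 * H) - |t - s| ^ (2 * H))
  continuous_paths : ∀ᵐ ω ∂P, Continuous fun t ↦ B t ω

/-- The fractional Ornstein-Uhlenbeck process `X t = e^{-θ t} ∫_0^t e^{θ s} dB_s`, `t ≥ 0`, started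
at zero; the integral is a pathwise Riemann-Stieltjes integral. -/
noncomputable def fouX {Ω : Type*} (θ : ℝ) (B : ℝ → Ω → ℝ) (t : ℝ) (ω : Ω) : ℝ :=
  Real.exp (-θ * t) * rsIntegral (fun s ↦ Real.exp (θ * s)) (fun s ↦ B s ω) 0 t

/-- The fractional Ornstein-Uhlenbeck process `Z t = ∫_{-∞}^t e^{-θ (t - s)} dB_s`; the integral is
a pathwise improper Riemann-Stieltjes integral. -/
noncomputable def fouZ {Ω : Type*} (θ : ℝ) (B : ℝ → Ω → ℝ) (t : ℝ) (ω : Ω) : ℝ :=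
  rsIntegralIic (fun s ↦ Real.exp (-θ * (t - s))) (fun s ↦ B s ω) t

/-- A real process indexed by `ℝ` is (strictly) stationary: for every shift `h`, the processes
`(Y (t + h))_t` and `(Y t)_t` have the same finite-dimensional distributions. -/
def IsStationaryProcess {Ω : Type*} [MeasurableSpace Ω] (Y : ℝ → Ω → ℝ) (P : Measure Ω) : Prop :=
  ∀ (h : ℝ) (I : Finset ℝ),
    IdentDistrib (fun ω (i : I) ↦ Y (i + h) ω) (fun ω (i : I) ↦ Y i ω) P P

/-- Ergodicity of a (stationary) process indexed by `ℝ`: every event `{Y ∈ A}`, with `A` a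
measurable set of paths, which is invariant up to null sets under all time shifts has probability
zero or one. (Exact invariance under all real shifts would be void here: a set of the product
σ-algebra depends on countably many coordinates only, so that the exactly invariant ones are
trivial.) -/
def IsErgodicProcess {Ω : Type*} [MeasurableSpace Ω] (Y : ℝ → Ω → ℝ) (P : Measure Ω) : Prop :=
  ∀ A : Set (ℝ → ℝ), MeasurableSet A →
    (∀ h : ℝ, ∀ᵐ ω ∂P, (fun t ↦ Y (t + h) ω) ∈ A ↔ (fun t ↦ Y t ω) ∈ A) →
    (∀ᵐ ω ∂P, (fun t ↦ Y t ω) ∈ A) ∨ (∀ᵐ ω ∂P, (fun t ↦ Y t ω) ∉ A)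

/-!
Integration by parts turns both integrals into pathwise Riemann integrals and gives
`X t = Z t - exp (-θ t) Z 0`; writing `Z t` as the mean of `B t - B (t - U)` over an exponential
time `U` shows that `Z` is a limit of Gaussian sums. The difference of two independent exponential
times has a two-sided exponential law, so the covariance of `Z` collapses to the mean second
difference of `½|·|^{2H}` over one exponential step, from which its value at `0` and its decay
`H(2H-1)θ⁻² t^{2H-2}` are read off. Vanishing covariance makes the stationary Gaussian process `Z`
mixing, hence ergodic, and all moments of a centered Gaussian variable are functions of its
variance. The improper integral converges because `B` grows polynomially: by time inversion,
`|t|^{2H} B (1/t)` has the law of `B t` for `t ≠ 0`, jointly in `t`, and so tends to `0` at `0`.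
-/

theorem exists_partition_of_mesh {a b δ : ℝ} (hab : a ≤ b) (hδ : 0 < δ) :
    ∃ (n : ℕ) (x : ℕ → ℝ), x 0 = a ∧ x n = b ∧ ∀ i < n, x i ≤ x (i + 1) ∧ x (i + 1) - x i < δ := by
  obtain ⟨n, hn⟩ := exists_nat_gt ((b - a) / δ)
  have hn_pos : (0 : ℝ) < n := (div_nonneg (sub_nonneg.2 hab) hδ.le).trans_lt hn
  have hstep_nonneg : 0 ≤ (b - a) / n := div_nonneg (sub_nonneg.2 hab) hn_pos.le
  have hstep_lt : (b - a) / n < δ := (div_lt_comm₀ hn_pos hδ).2 hn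
  refine ⟨n, fun i ↦ a + i * ((b - a) / n), by simp, by field_simp; ring, fun i _ ↦ ?_⟩
  push_cast
  constructor <;> linarith

theorem HasRSIntegral.unique {f g : ℝ → ℝ} {a b I J : ℝ} (hI : HasRSIntegral f g a b I)
    (hJ : HasRSIntegral f g a b J) : I = J := by
  refine eq_of_forall_dist_le fun ε hε ↦ ?_
  obtain ⟨δ₁, hδ₁, hI'⟩ := hI.2 (ε / 2) (half_pos hε)
  obtain ⟨δ₂, hδ₂, hJ'⟩ := hJ.2 (ε / 2) (half_pos hε)
  obtain ⟨n, x, hx0, hxn, hx⟩ := exists_partition_of_mesh hI.1 (lt_min hδ₁ hδ₂)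
  have hSI := hI' n x x hx0 hxn fun i hi ↦
    ⟨le_rfl, (hx i hi).1, (hx i hi).2.trans_le (min_le_left _ _)⟩
  have hSJ := hJ' n x x hx0 hxn fun i hi ↦
    ⟨le_rfl, (hx i hi).1, (hx i hi).2.trans_le (min_le_right _ _)⟩
  rw [← Real.dist_eq] at hSI hSJ
  linarith [dist_triangle_left I J (∑ i ∈ Finset.range n, f (x i) * (g (x (i + 1)) - g (x i)))]

theorem HasRSIntegral.rsIntegral_eq {f g : ℝ → ℝ} {a b I : ℝ} (h : HasRSIntegral f g a b I) :
    rsIntegral f g a b = I := by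
  have hex : ∃ I, HasRSIntegral f g a b I := ⟨I, h⟩
  rw [rsIntegral, dif_pos hex]
  exact hex.choose_spec.unique h

theorem HasRSIntegralIic.rsIntegralIic_eq {f g : ℝ → ℝ} {b I : ℝ} (h : HasRSIntegralIic f g b I) :
    rsIntegralIic f g b = I := by
  have hex : ∃ I, HasRSIntegralIic f g b I := ⟨I, h⟩
  rw [rsIntegralIic, dif_pos hex]
  exact tendsto_nhds_unique hex.choose_spec.2 h.2

theorem HasRSIntegral.tendsto_sum_uniform {f g : ℝ → ℝ} {a b I : ℝ} (h : HasRSIntegral f g a b I) :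
    Tendsto (fun n : ℕ ↦ ∑ i ∈ Finset.range n, f (a + i * ((b - a) / n)) *
      (g (a + (i + 1 : ℕ) * ((b - a) / n)) - g (a + i * ((b - a) / n)))) atTop (𝓝 I) := by
  rw [Metric.tendsto_nhds]
  intro ε hε
  obtain ⟨δ, hδ, hI⟩ := h.2 ε hε
  have hmesh : ∀ᶠ n : ℕ in atTop, (b - a) / n < δ :=
    (tendsto_const_div_atTop_nhds_zero_nat (b - a)).eventually (gt_mem_nhds hδ)
  filter_upwards [hmesh, eventually_ne_atTop 0] with n hn hn0
  have hstep_nonneg : 0 ≤ (b - a) / n := div_nonneg (sub_nonneg.2 h.1) n.cast_nonneg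
  refine hI n (fun i ↦ a + i * ((b - a) / n)) (fun i ↦ a + i * ((b - a) / n)) (by simp)
    (by field_simp; ring) fun i _ ↦ ?_
  push_cast
  exact ⟨le_rfl, by linarith, by linarith⟩

section IntegrationByParts

variable {f f' g : ℝ → ℝ}

theorem integral_deriv_mul_const_sub {p q : ℝ} (hpq : p ≤ q)
    (hf : ∀ s ∈ Set.Icc p q, HasDerivAt f (f' s) s) (hf' : ContinuousOn f' (Set.Icc p q))
    (hg : ContinuousOn g (Set.Icc p q)) (c : ℝ) :
    ∫ s in p..q, f' s * (c - g s) = (f q - f p) * c - ∫ s in p..q, f' s * g s := by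
  have hint : IntervalIntegrable f' volume p q := hf'.intervalIntegrable_of_Icc hpq
  have hint_mul : IntervalIntegrable (fun s ↦ f' s * g s) volume p q :=
    (hf'.mul hg).intervalIntegrable_of_Icc hpq
  simp_rw [mul_sub]
  rw [intervalIntegral.integral_sub (hint.mul_const c) hint_mul,
    intervalIntegral.integral_mul_const,
    intervalIntegral.integral_eq_sub_of_hasDerivAt (by rwa [Set.uIcc_of_le hpq]) hint]

theorem abs_integral_mul_const_sub_le {p q c M η : ℝ} (hpq : p ≤ q)
    (hM : ∀ s ∈ Set.Icc p q, |f' s| ≤ M) (hη : ∀ s ∈ Set.Icc p q, |c - g s| ≤ η) :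
    |∫ s in p..q, f' s * (c - g s)| ≤ M * η * (q - p) := by
  rw [← abs_of_nonneg (sub_nonneg.2 hpq), ← Real.norm_eq_abs]
  refine intervalIntegral.norm_integral_le_of_norm_le_const fun s hs ↦ ?_
  have hs' : s ∈ Set.Icc p q := Set.Ioc_subset_Icc_self (Set.uIoc_of_le hpq ▸ hs)
  rw [norm_mul]
  exact mul_le_mul (hM s hs') (hη s hs') (abs_nonneg _) ((abs_nonneg _).trans (hM s hs'))

theorem abs_rsCell_sub_le {x ξ y M η : ℝ} (hxξ : x ≤ ξ) (hξy : ξ ≤ y)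
    (hf : ∀ s ∈ Set.Icc x y, HasDerivAt f (f' s) s) (hf' : ContinuousOn f' (Set.Icc x y))
    (hg : ContinuousOn g (Set.Icc x y)) (hM : ∀ s ∈ Set.Icc x y, |f' s| ≤ M)
    (hη : ∀ s ∈ Set.Icc x y, ∀ r ∈ Set.Icc x y, |g r - g s| ≤ η) :
    |f ξ * (g y - g x) - (f y * g y - f x * g x - ∫ s in x..y, f' s * g s)| ≤
      M * η * (y - x) := by
  have hleft : Set.Icc x ξ ⊆ Set.Icc x y := Set.Icc_subset_Icc_right hξy
  have hright : Set.Icc ξ y ⊆ Set.Icc x y := Set.Icc_subset_Icc_left hxξ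
  have hfg : ContinuousOn (fun s ↦ f' s * g s) (Set.Icc x y) := hf'.mul hg
  have hcell : f ξ * (g y - g x) - (f y * g y - f x * g x - ∫ s in x..y, f' s * g s) =
      -(∫ s in ξ..y, f' s * (g y - g s)) - ∫ s in x..ξ, f' s * (g x - g s) := by
    rw [integral_deriv_mul_const_sub hξy (fun s hs ↦ hf s (hright hs)) (hf'.mono hright)
        (hg.mono hright),
      integral_deriv_mul_const_sub hxξ (fun s hs ↦ hf s (hleft hs)) (hf'.mono hleft)
        (hg.mono hleft),
      ← intervalIntegral.integral_add_adjacent_intervals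
        ((hfg.mono hleft).intervalIntegrable_of_Icc hxξ)
        ((hfg.mono hright).intervalIntegrable_of_Icc hξy)]
    ring
  have hbound_right := abs_integral_mul_const_sub_le hξy (fun s hs ↦ hM s (hright hs))
    fun s hs ↦ hη s (hright hs) y ⟨hxξ.trans hξy, le_rfl⟩
  have hbound_left := abs_integral_mul_const_sub_le hxξ (fun s hs ↦ hM s (hleft hs))
    fun s hs ↦ hη s (hleft hs) x ⟨le_rfl, hxξ.trans hξy⟩
  rw [hcell]
  refine (abs_sub _ _).trans ?_
  rw [abs_neg]
  linarith

theorem abs_rsSum_sub_le {a b M η δ : ℝ} {n : ℕ} {x ξ : ℕ → ℝ} (hx0 : x 0 = a) (hxn : x n = b)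
    (hξ : ∀ i < n, x i ≤ ξ i ∧ ξ i ≤ x (i + 1) ∧ x (i + 1) - x i < δ)
    (hf : ∀ s ∈ Set.Icc a b, HasDerivAt f (f' s) s) (hf' : ContinuousOn f' (Set.Icc a b))
    (hg : ContinuousOn g (Set.Icc a b)) (hM : ∀ s ∈ Set.Icc a b, |f' s| ≤ M)
    (hη : ∀ s ∈ Set.Icc a b, ∀ r ∈ Set.Icc a b, |r - s| < δ → |g r - g s| ≤ η) :
    |∑ i ∈ Finset.range n, f (ξ i) * (g (x (i + 1)) - g (x i)) -
      (f b * g b - f a * g a - ∫ s in a..b, f' s * g s)| ≤ M * η * (b - a) := by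
  have hstep : ∀ i < n, x i ≤ x (i + 1) := fun i hi ↦ (hξ i hi).1.trans (hξ i hi).2.1
  have hmono : ∀ i j, i ≤ j → j ≤ n → x i ≤ x j := by
    intro i j hij
    induction j, hij using Nat.le_induction with
    | base => exact fun _ ↦ le_rfl
    | succ k _ ih => exact fun hk ↦ (ih (by omega)).trans (hstep k (by omega))
  have hsub : ∀ i < n, Set.Icc (x i) (x (i + 1)) ⊆ Set.Icc a b := fun i hi ↦
    Set.Icc_subset_Icc (hx0 ▸ hmono 0 i i.zero_le hi.le) (hxn ▸ hmono (i + 1) n hi le_rfl)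
  have hfg : ContinuousOn (fun s ↦ f' s * g s) (Set.Icc a b) := hf'.mul hg
  have htelescope : f b * g b - f a * g a - ∫ s in a..b, f' s * g s =
      ∑ i ∈ Finset.range n, (f (x (i + 1)) * g (x (i + 1)) - f (x i) * g (x i) -
        ∫ s in x i..x (i + 1), f' s * g s) := by
    rw [Finset.sum_sub_distrib, Finset.sum_range_sub (fun i ↦ f (x i) * g (x i)),
      intervalIntegral.sum_integral_adjacent_intervals fun i hi ↦
        (hfg.mono (hsub i hi)).intervalIntegrable_of_Icc (hstep i hi), hx0, hxn]
  rw [htelescope, ← Finset.sum_sub_distrib, ← hx0, ← hxn, ← Finset.sum_range_sub, Finset.mul_sum]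
  refine (Finset.abs_sum_le_sum_abs _ _).trans (Finset.sum_le_sum fun i hi ↦ ?_)
  rw [Finset.mem_range] at hi
  obtain ⟨hxξ, hξx, hmesh⟩ := hξ i hi
  exact abs_rsCell_sub_le hxξ hξx (fun s hs ↦ hf s (hsub i hi hs)) (hf'.mono (hsub i hi))
    (hg.mono (hsub i hi)) (fun s hs ↦ hM s (hsub i hi hs)) fun s hs r hr ↦
      hη s (hsub i hi hs) r (hsub i hi hr) ((Real.dist_le_of_mem_Icc hr hs).trans_lt hmesh)

theorem hasRSIntegral_of_hasDerivAt {a b : ℝ} (hab : a ≤ b)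
    (hf : ∀ s ∈ Set.Icc a b, HasDerivAt f (f' s) s) (hf' : ContinuousOn f' (Set.Icc a b))
    (hg : ContinuousOn g (Set.Icc a b)) :
    HasRSIntegral f g a b (f b * g b - f a * g a - ∫ s in a..b, f' s * g s) := by
  refine ⟨hab, fun ε hε ↦ ?_⟩
  obtain ⟨M, hM⟩ := isCompact_Icc.exists_bound_of_continuousOn hf'
  obtain ⟨η, hη, hηε⟩ : ∃ η > 0, M * (b - a) * η < ε := exists_pos_mul_lt hε _
  obtain ⟨δ, hδ, hgδ⟩ := Metric.uniformContinuousOn_iff.1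
    (isCompact_Icc.uniformContinuousOn_of_continuous hg) η hη
  refine ⟨δ, hδ, fun n x ξ hx0 hxn hξ ↦ ?_⟩
  calc _ ≤ M * η * (b - a) := abs_rsSum_sub_le hx0 hxn hξ hf hf' hg hM fun s hs r hr hrs ↦
        (hgδ r hr s hs hrs).le
    _ < ε := by linarith

end IntegrationByParts

theorem hasRSIntegral_exp_sub (θ r : ℝ) {g : ℝ → ℝ} {a b : ℝ} (hab : a ≤ b)
    (hg : ContinuousOn g (Set.Icc a b)) :
    HasRSIntegral (fun s ↦ Real.exp (-θ * (r - s))) g a b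
      (Real.exp (-θ * (r - b)) * g b - Real.exp (-θ * (r - a)) * g a -
        θ * ∫ s in a..b, Real.exp (-θ * (r - s)) * g s) := by
  have hderiv (s : ℝ) : HasDerivAt (fun s ↦ Real.exp (-θ * (r - s)))
      (θ * Real.exp (-θ * (r - s))) s := by
    simpa [mul_comm] using (((hasDerivAt_id s).const_sub r).const_mul (-θ)).exp
  simp_rw [← intervalIntegral.integral_const_mul, ← mul_assoc]
  exact hasRSIntegral_of_hasDerivAt hab (fun s _ ↦ hderiv s) (by fun_prop) hg

theorem exp_neg_mul_sub_eq_mul (θ r s : ℝ) :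
    Real.exp (-θ * (r - s)) = Real.exp (-θ * r) * Real.exp (θ * s) := by
  rw [← Real.exp_add]
  ring_nf

theorem setIntegral_Ioi_zero_eq_Iic (F : ℝ → ℝ) (t : ℝ) :
    ∫ u in Set.Ioi (0 : ℝ), F u = ∫ s in Set.Iic t, F (t - s) := by
  rw [integral_Iic_eq_integral_Iio, ← integral_indicator measurableSet_Ioi,
    ← integral_indicator measurableSet_Iio, ← integral_sub_left_eq_self _ _ t]
  simp [Set.indicator]

/-- A continuous path which grows more slowly than every exponential at `-∞`, so that all its
integrals against `exp (θ * s)`, `0 < θ`, converge there. -/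
structure IsSubexponentialPath (g : ℝ → ℝ) : Prop where
  continuous : Continuous g
  isBigO : ∀ c > 0, g =O[atBot] fun s ↦ Real.exp (-c * s)

namespace IsSubexponentialPath

variable {g : ℝ → ℝ} {θ : ℝ}

theorem isBigO_exp_mul (hg : IsSubexponentialPath g) (hθ : 0 < θ) (r : ℝ) :
    (fun s ↦ Real.exp (-θ * (r - s)) * g s) =O[atBot] fun s ↦ Real.exp (θ / 2 * s) := by
  have hmul := (Asymptotics.isBigO_refl (fun s ↦ Real.exp (-θ * (r - s))) atBot).mul
    (hg.isBigO (θ / 2) (half_pos hθ))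
  refine hmul.trans (.of_bound (Real.exp (-θ * r)) (.of_forall fun s ↦ le_of_eq ?_))
  rw [← Real.exp_add, Real.norm_eq_abs, Real.norm_eq_abs, Real.abs_exp, Real.abs_exp,
    ← Real.exp_add]
  ring_nf

theorem tendsto_exp_mul_atBot (hg : IsSubexponentialPath g) (hθ : 0 < θ) (r : ℝ) :
    Tendsto (fun s ↦ Real.exp (-θ * (r - s)) * g s) atBot (𝓝 0) :=
  (hg.isBigO_exp_mul hθ r).trans_tendsto
    (Real.tendsto_exp_atBot.comp (tendsto_id.const_mul_atBot (half_pos hθ)))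

theorem integrableOn_exp_mul (hg : IsSubexponentialPath g) (hθ : 0 < θ) (r b : ℝ) :
    IntegrableOn (fun s ↦ Real.exp (-θ * (r - s)) * g s) (Set.Iic b) := by
  have hcont : Continuous fun s ↦ Real.exp (-θ * (r - s)) * g s :=
    (by fun_prop : Continuous fun s ↦ Real.exp (-θ * (r - s))).mul hg.continuous
  exact (hcont.locallyIntegrable.locallyIntegrableOn _).integrableOn_of_isBigO_atBot
    (hg.isBigO_exp_mul hθ r)
    ⟨Set.Iic 0, Iic_mem_atBot 0, integrableOn_exp_mul_Iic (half_pos hθ) 0⟩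

theorem hasRSIntegralIic_exp_sub (hg : IsSubexponentialPath g) (hθ : 0 < θ) (r b : ℝ) :
    HasRSIntegralIic (fun s ↦ Real.exp (-θ * (r - s))) g b
      (Real.exp (-θ * (r - b)) * g b - θ * ∫ s in Set.Iic b, Real.exp (-θ * (r - s)) * g s) := by
  have hRS (a : ℝ) (hab : a ≤ b) := hasRSIntegral_exp_sub θ r hab hg.continuous.continuousOn
  refine ⟨fun a hab ↦ ⟨_, hRS a hab⟩, ?_⟩
  have hlim := ((hg.tendsto_exp_mul_atBot hθ r).const_sub (Real.exp (-θ * (r - b)) * g b)).sub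
    ((intervalIntegral_tendsto_integral_Iic b (hg.integrableOn_exp_mul hθ r b)
      tendsto_id).const_mul θ)
  rw [sub_zero] at hlim
  refine hlim.congr' ?_
  filter_upwards [eventually_le_atBot b] with a hab
  exact (hRS a hab).rsIntegral_eq.symm

theorem exp_mul_rsIntegral_eq (hg : IsSubexponentialPath g) (hθ : 0 < θ) {t : ℝ} (ht : 0 ≤ t) :
    Real.exp (-θ * t) * rsIntegral (fun s ↦ Real.exp (θ * s)) g 0 t =
      rsIntegralIic (fun s ↦ Real.exp (-θ * (t - s))) g t -
        Real.exp (-θ * t) * rsIntegralIic (fun s ↦ Real.exp (-θ * (0 - s))) g 0 := by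
  have hRS := hasRSIntegral_exp_sub θ 0 ht hg.continuous.continuousOn
  have hint (b : ℝ) := hg.integrableOn_exp_mul hθ 0 b
  rw [(hg.hasRSIntegralIic_exp_sub hθ t t).rsIntegralIic_eq,
    (hg.hasRSIntegralIic_exp_sub hθ 0 0).rsIntegralIic_eq]
  rw [← intervalIntegral.integral_Iic_sub_Iic (hint 0) (hint t)] at hRS
  simp only [exp_neg_mul_sub_eq_mul, mul_zero, Real.exp_zero, one_mul, mul_assoc,
    integral_const_mul] at hRS ⊢
  rw [hRS.rsIntegral_eq]
  ring

theorem hasRSIntegralIic_exp_sub_increment (hg : IsSubexponentialPath g) (hθ : 0 < θ) (t : ℝ) :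
    HasRSIntegralIic (fun s ↦ Real.exp (-θ * (t - s))) g t
      (θ * ∫ u in Set.Ioi (0 : ℝ), Real.exp (-θ * u) * (g t - g (t - u))) := by
  convert hg.hasRSIntegralIic_exp_sub hθ t t using 1
  have hconst : IntegrableOn (fun s ↦ Real.exp (-θ * (t - s)) * g t) (Set.Iic t) := by
    simp_rw [exp_neg_mul_sub_eq_mul]
    exact ((integrableOn_exp_mul_Iic hθ t).const_mul _).mul_const _
  have hvalue : ∫ s in Set.Iic t, Real.exp (-θ * (t - s)) * g t = θ⁻¹ * g t := by
    simp_rw [exp_neg_mul_sub_eq_mul]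
    rw [integral_mul_const, integral_const_mul, integral_exp_mul_Iic hθ, ← mul_div_assoc,
      ← Real.exp_add, neg_mul, neg_add_cancel, Real.exp_zero, one_div]
  have hsub : ∫ u in Set.Ioi (0 : ℝ), Real.exp (-θ * u) * (g t - g (t - u)) =
      θ⁻¹ * g t - ∫ s in Set.Iic t, Real.exp (-θ * (t - s)) * g s := by
    rw [setIntegral_Ioi_zero_eq_Iic _ t, ← hvalue,
      ← integral_sub hconst (hg.integrableOn_exp_mul hθ t t)]
    simp only [sub_sub_cancel, mul_sub]
  rw [hsub, mul_sub, mul_inv_cancel_left₀ hθ.ne', sub_self, mul_zero, Real.exp_zero, one_mul]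

end IsSubexponentialPath

theorem factorial_two_mul_div_eq_doubleFactorial (k : ℕ) :
    ((2 * k)! : ℝ) / (2 ^ k * (k ! : ℝ)) = ((2 * k - 1)‼ : ℝ) := by
  rcases k with - | k
  · simp
  rw [div_eq_iff (by positivity), show 2 * (k + 1) - 1 = 2 * k + 1 by omega]
  have hfactor := Nat.factorial_eq_mul_doubleFactorial (2 * k + 1)
  rw [show 2 * k + 1 + 1 = 2 * (k + 1) by ring, Nat.doubleFactorial_two_mul] at hfactor
  exact_mod_cast hfactor.trans (mul_comm _ _)

theorem inv_rpow_neg_add_half {b : ℝ} (hb : 0 < b) (k : ℕ) :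
    b⁻¹ ^ (-(2 * k + 1 : ℝ) / 2) = b ^ k * √b := by
  rw [Real.inv_rpow hb.le, ← Real.rpow_neg hb.le, Real.sqrt_eq_rpow, ← Real.rpow_natCast,
    ← Real.rpow_add hb]
  ring_nf

theorem integral_pow_two_mul_gaussianReal (v : NNReal) (k : ℕ) :
    ∫ x, x ^ (2 * k) ∂(gaussianReal 0 v) = ((2 * k)! : ℝ) / (2 ^ k * (k ! : ℝ)) * (v : ℝ) ^ k := by
  rcases eq_or_ne v 0 with rfl | hv
  · rcases k with - | k <;> simp
  have hdensity (x : ℝ) : gaussianPDFReal 0 v x • x ^ (2 * k) =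
      (√(2 * Real.pi * v))⁻¹ * (|x| ^ (2 * k : ℝ) * Real.exp (-(2 * v : ℝ)⁻¹ * |x| ^ (2 : ℝ))) := by
    rw [gaussianPDFReal, smul_eq_mul, mul_assoc, mul_comm (Real.exp _)]
    norm_cast
    rw [(even_two_mul k).pow_abs, sq_abs, sub_zero, neg_div, neg_mul, div_eq_inv_mul]
    push_cast
    rfl
  have hsqrt : √(2 * Real.pi * v) = √(2 * v) * √Real.pi := by
    rw [← Real.sqrt_mul (by positivity)]
    ring_nf
  rw [integral_gaussianReal_eq_integral_smul hv, integral_congr_ae (.of_forall hdensity),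
    integral_const_mul,
    integral_comp_abs (f := fun x ↦ x ^ (2 * k : ℝ) * Real.exp (-(2 * v : ℝ)⁻¹ * x ^ (2 : ℝ))),
    integral_rpow_mul_exp_neg_mul_rpow two_pos (by linarith [k.cast_nonneg (α := ℝ)])
      (by positivity), inv_rpow_neg_add_half (by positivity),
    show (2 * k + 1 : ℝ) / 2 = k + 1 / 2 by ring, Real.Gamma_nat_add_half,
    factorial_two_mul_div_eq_doubleFactorial, hsqrt, mul_pow]
  field_simp

theorem integral_pow_gaussianReal_of_odd (v : NNReal) {n : ℕ} (hn : Odd n) :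
    ∫ x, x ^ n ∂(gaussianReal 0 v) = 0 := by
  have hneg : ∫ x, x ^ n ∂(gaussianReal 0 v) = -∫ x, x ^ n ∂(gaussianReal 0 v) := by
    conv_lhs => rw [← neg_zero, ← gaussianReal_map_neg, integral_map (by fun_prop) (by fun_prop)]
    simp_rw [hn.neg_pow, integral_neg]
  linarith

section Centered

variable {Ω : Type*} [MeasurableSpace Ω] {P : Measure Ω} {Y : Ω → ℝ}

theorem map_eq_gaussianReal_of_centered (hY : HasGaussianLaw Y P) (hY₀ : ∫ ω, Y ω ∂P = 0) :
    P.map Y = gaussianReal 0 (∫ ω, Y ω ^ 2 ∂P).toNNReal := by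
  rw [hY.map_eq_gaussianReal, hY₀, variance_of_integral_eq_zero hY.aemeasurable hY₀]

theorem integral_pow_of_centered (hY : HasGaussianLaw Y P) (hY₀ : ∫ ω, Y ω ∂P = 0) (n : ℕ) :
    ∫ ω, Y ω ^ n ∂P = ∫ x, x ^ n ∂(gaussianReal 0 (∫ ω, Y ω ^ 2 ∂P).toNNReal) := by
  rw [← map_eq_gaussianReal_of_centered hY hY₀, integral_map hY.aemeasurable (by fun_prop)]

theorem integral_pow_of_centered_of_even (hY : HasGaussianLaw Y P) (hY₀ : ∫ ω, Y ω ∂P = 0)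
    {n : ℕ} (hn : Even n) :
    ∫ ω, Y ω ^ n ∂P =
      (n ! : ℝ) / (2 ^ (n / 2) * ((n / 2)! : ℝ)) * (∫ ω, Y ω ^ 2 ∂P) ^ (n / 2) := by
  obtain ⟨k, rfl⟩ := hn.two_dvd
  rw [Nat.mul_div_cancel_left k two_pos, integral_pow_of_centered hY hY₀,
    integral_pow_two_mul_gaussianReal,
    Real.coe_toNNReal _ (integral_nonneg fun ω ↦ sq_nonneg (Y ω))]

theorem integral_pow_eq_zero_of_centered_of_odd (hY : HasGaussianLaw Y P)
    (hY₀ : ∫ ω, Y ω ∂P = 0) {n : ℕ} (hn : Odd n) : ∫ ω, Y ω ^ n ∂P = 0 := by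
  rw [integral_pow_of_centered hY hY₀, integral_pow_gaussianReal_of_odd _ hn]

end Centered

section GaussianLimit

variable {Ω : Type*} [MeasurableSpace Ω] {P : Measure Ω}

theorem charFun_gaussianReal_zero_toNNReal {v : ℝ} (hv : 0 ≤ v) (u : ℝ) :
    charFun (gaussianReal 0 v.toNNReal) u = Complex.exp (-(v * u ^ 2 / 2 : ℝ)) := by
  rw [charFun_gaussianReal, Real.coe_toNNReal _ hv]
  push_cast
  ring_nf

theorem charFun_map_of_centered {Y : Ω → ℝ} (hY : HasGaussianLaw Y P) (hY₀ : ∫ ω, Y ω ∂P = 0)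
    (u : ℝ) :
    charFun (P.map Y) u = Complex.exp (-((∫ ω, Y ω ^ 2 ∂P) * u ^ 2 / 2 : ℝ)) := by
  rw [map_eq_gaussianReal_of_centered hY hY₀,
    charFun_gaussianReal_zero_toNNReal (integral_nonneg fun ω ↦ sq_nonneg (Y ω))]

theorem exists_ne_zero_charFun_ne_zero (μ : Measure ℝ) [IsProbabilityMeasure μ] :
    ∃ u ≠ 0, charFun μ u ≠ 0 := by
  have hcont : Continuous (charFun μ) := continuous_charFun
  have hne : ∀ᶠ u in 𝓝[≠] (0 : ℝ), charFun μ u ≠ 0 :=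
    (hcont.continuousAt.eventually_ne (by simp)).filter_mono nhdsWithin_le_nhds
  exact ((eventually_mem_nhdsWithin (α := ℝ)).and hne).exists

-- The limit cannot vanish identically away from `0`, so the exponents can be recovered from it.
theorem exists_tendsto_of_tendsto_charFun_gaussianReal {v : ℕ → ℝ} (hv : ∀ n, 0 ≤ v n)
    {μ : Measure ℝ} [IsProbabilityMeasure μ]
    (h : ∀ u, Tendsto (fun n ↦ charFun (gaussianReal 0 (v n).toNNReal) u) atTop
      (𝓝 (charFun μ u))) :
    ∃ v', Tendsto v atTop (𝓝 v') := by
  obtain ⟨u, hu, hμu⟩ := exists_ne_zero_charFun_ne_zero μ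
  have hnorm := (h u).norm
  simp_rw [charFun_gaussianReal_zero_toNNReal (hv _), ← Complex.ofReal_neg, ← Complex.ofReal_exp,
    Complex.norm_real, Real.norm_of_nonneg (Real.exp_pos _).le] at hnorm
  have hlog := (Real.continuousAt_log (norm_ne_zero_iff.2 hμu)).tendsto.comp hnorm
  simp only [Function.comp_def, Real.log_exp] at hlog
  refine ⟨_, (hlog.const_mul (-(2 / u ^ 2))).congr fun n ↦ ?_⟩
  field_simp

theorem exists_eq_gaussianReal_of_tendsto_charFun {v : ℕ → ℝ} (hv : ∀ n, 0 ≤ v n)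
    {μ : Measure ℝ} [IsProbabilityMeasure μ]
    (h : ∀ u, Tendsto (fun n ↦ charFun (gaussianReal 0 (v n).toNNReal) u) atTop
      (𝓝 (charFun μ u))) :
    ∃ v', μ = gaussianReal 0 v' := by
  obtain ⟨v', hv'⟩ := exists_tendsto_of_tendsto_charFun_gaussianReal hv h
  refine ⟨v'.toNNReal, Measure.ext_of_charFun (funext fun u ↦ tendsto_nhds_unique (h u) ?_)⟩
  simp_rw [charFun_gaussianReal_zero_toNNReal (ge_of_tendsto' hv' hv),
    charFun_gaussianReal_zero_toNNReal (hv _)]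
  exact ((by fun_prop : Continuous fun x : ℝ ↦
    Complex.exp (-(x * u ^ 2 / 2 : ℝ))).tendsto v').comp hv'

theorem hasGaussianLaw_and_centered_of_ae_tendsto [IsProbabilityMeasure P] {Y : ℕ → Ω → ℝ}
    {Z : Ω → ℝ} (hY : ∀ n, HasGaussianLaw (Y n) P) (hY₀ : ∀ n, ∫ ω, Y n ω ∂P = 0)
    (h : ∀ᵐ ω ∂P, Tendsto (fun n ↦ Y n ω) atTop (𝓝 (Z ω))) :
    HasGaussianLaw Z P ∧ ∫ ω, Z ω ∂P = 0 := by
  have hZ : AEMeasurable Z P :=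
    aemeasurable_of_tendsto_metrizable_ae' (fun n ↦ (hY n).aemeasurable) h
  have := Measure.isProbabilityMeasure_map hZ
  have hlim := ProbabilityMeasure.tendsto_iff_tendsto_charFun.1
    (tendstoInDistribution_of_ae_tendsto (fun n ↦ (hY n).aemeasurable) hZ h).tendsto
  simp only [ProbabilityMeasure.coe_mk, map_eq_gaussianReal_of_centered (hY _) (hY₀ _)] at hlim
  obtain ⟨v, hlaw⟩ := exists_eq_gaussianReal_of_tendsto_charFun
    (fun n ↦ integral_nonneg fun ω ↦ sq_nonneg (Y n ω)) hlim
  refine ⟨⟨by rw [hlaw]; infer_instance⟩, ?_⟩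
  rw [← integral_map (f := fun x : ℝ ↦ x) hZ (by fun_prop), hlaw, integral_id_gaussianReal]

theorem hasGaussianLaw_comp_measurePreserving {Ω' E : Type*} [MeasurableSpace Ω']
    [TopologicalSpace E] [AddCommMonoid E] [Module ℝ E] [MeasurableSpace E] {P' : Measure Ω'}
    {X : Ω → E} (hX : HasGaussianLaw X P) {f : Ω' → Ω} (hf : MeasurePreserving f P' P) :
    HasGaussianLaw (fun ω ↦ X (f ω)) P' := by
  refine ⟨?_⟩
  have hmap := AEMeasurable.map_map_of_aemeasurable (hf.map_eq ▸ hX.aemeasurable) hf.aemeasurable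
  rw [hf.map_eq] at hmap
  exact hmap ▸ hX.isGaussian_map

end GaussianLimit

/-- A real Gaussian process all of whose coordinates are centered. -/
structure IsCenteredGaussianProcess {T Ω : Type*} [MeasurableSpace Ω] (X : T → Ω → ℝ)
    (P : Measure Ω) : Prop where
  gaussian : IsGaussianProcess X P
  centered : ∀ t, ∫ ω, X t ω ∂P = 0

namespace IsCenteredGaussianProcess

section

variable {Ω S T : Type*} [MeasurableSpace Ω] {P : Measure Ω} {X : T → Ω → ℝ}

theorem congr {Y : T → Ω → ℝ} (hX : IsCenteredGaussianProcess X P) (h : ∀ t, X t =ᵐ[P] Y t) :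
    IsCenteredGaussianProcess Y P :=
  ⟨hX.gaussian.congr h, fun t ↦ by rw [← integral_congr_ae (h t), hX.centered]⟩

theorem comp_right (hX : IsCenteredGaussianProcess X P) (s : S → T) :
    IsCenteredGaussianProcess (fun i ↦ X (s i)) P :=
  ⟨hX.gaussian.comp_right s, fun i ↦ hX.centered (s i)⟩

theorem const_mul (hX : IsCenteredGaussianProcess X P) (c : T → ℝ) :
    IsCenteredGaussianProcess (fun t ω ↦ c t * X t ω) P :=
  ⟨hX.gaussian.smul c, fun t ↦ by rw [integral_const_mul, hX.centered, mul_zero]⟩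

theorem memLp_two (hX : IsCenteredGaussianProcess X P) (t : T) : MemLp (X t) 2 P :=
  (hX.gaussian.hasGaussianLaw_eval t).memLp_two

theorem integrable (hX : IsCenteredGaussianProcess X P) (t : T) : Integrable (X t) P :=
  (hX.gaussian.hasGaussianLaw_eval t).integrable

theorem integrable_mul (hX : IsCenteredGaussianProcess X P) (s t : T) :
    Integrable (fun ω ↦ X s ω * X t ω) P :=
  (hX.memLp_two s).integrable_mul (hX.memLp_two t)

theorem aemeasurable_pi [Countable T] (hX : IsCenteredGaussianProcess X P) :
    AEMeasurable (fun ω t ↦ X t ω) P :=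
  aemeasurable_pi_lambda _ fun t ↦ hX.gaussian.aemeasurable t

theorem aemeasurable_toLp [Countable T] (hX : IsCenteredGaussianProcess X P) :
    AEMeasurable (fun ω ↦ WithLp.toLp 2 (X · ω)) P :=
  (PiLp.continuous_toLp 2 _).measurable.comp_aemeasurable hX.aemeasurable_pi

theorem hasGaussianLaw_pi [Finite T] (hX : IsCenteredGaussianProcess X P) :
    HasGaussianLaw (fun ω ↦ (X · ω)) P := by
  have := Fintype.ofFinite T
  let L : (↥(Finset.univ : Finset T) → ℝ) →L[ℝ] T → ℝ :=
    ContinuousLinearMap.pi fun t ↦ ContinuousLinearMap.proj ⟨t, Finset.mem_univ t⟩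
  exact (hX.gaussian.hasGaussianLaw Finset.univ).map_fun L

theorem integral_clm {I : Finset T} (hX : IsCenteredGaussianProcess X P)
    (L : (I → ℝ) →L[ℝ] ℝ) : ∫ ω, L (I.restrict (X · ω)) ∂P = 0 := by
  have hzero : ∫ ω, I.restrict (X · ω) ∂P = 0 := by
    ext i
    exact (eval_integral (fun j : I ↦ hX.integrable j) i).trans (hX.centered i)
  rw [L.integral_comp_comm (hX.gaussian.hasGaussianLaw I).integrable, hzero, map_zero]

theorem of_forall_clm (hX : IsCenteredGaussianProcess X P) {Y : S → Ω → ℝ}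
    (h : ∀ s, ∃ I : Finset T, ∃ L : (I → ℝ) →L[ℝ] ℝ, ∀ ω, Y s ω = L (I.restrict (X · ω))) :
    IsCenteredGaussianProcess Y P :=
  ⟨hX.gaussian.of_isGaussianProcess h, fun s ↦ by
    obtain ⟨I, L, hL⟩ := h s
    simp_rw [hL, hX.integral_clm]⟩

theorem of_ae_tendsto [IsProbabilityMeasure P] {Y : ℕ → T → Ω → ℝ}
    (hY : ∀ n, IsCenteredGaussianProcess (Y n) P)
    (h : ∀ t, ∀ᵐ ω ∂P, Tendsto (fun n ↦ Y n t ω) atTop (𝓝 (X t ω))) :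
    IsCenteredGaussianProcess X P := by
  have hX (t : T) : AEMeasurable (X t) P :=
    aemeasurable_of_tendsto_metrizable_ae' (fun n ↦ (hY n).gaussian.aemeasurable t) (h t)
  refine ⟨⟨fun I ↦ ⟨isGaussian_of_isGaussian_map fun L ↦ ?_⟩⟩, fun t ↦ ?_⟩
  · have hrestrict : AEMeasurable (fun ω ↦ I.restrict (X · ω)) P :=
      aemeasurable_pi_lambda _ fun _ ↦ hX _
    rw [AEMeasurable.map_map_of_aemeasurable (by fun_prop) hrestrict]
    refine (hasGaussianLaw_and_centered_of_ae_tendsto (Y := fun n ω ↦ L (I.restrict (Y n · ω)))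
      (fun n ↦ ((hY n).gaussian.hasGaussianLaw I).map L)
      (fun n ↦ (hY n).integral_clm L) ?_).1.isGaussian_map
    filter_upwards [ae_all_iff.2 fun i : I ↦ h i] with ω hω
    exact (L.continuous.tendsto _).comp (tendsto_pi_nhds.2 hω)
  · exact (hasGaussianLaw_and_centered_of_ae_tendsto
      (fun n ↦ (hY n).gaussian.hasGaussianLaw_eval t) (fun n ↦ (hY n).centered t) (h t)).2

theorem integral_sum_sq [Fintype T] (hX : IsCenteredGaussianProcess X P) (c : T → ℝ) :
    ∫ ω, (∑ i, c i * X i ω) ^ 2 ∂P = ∑ i, ∑ j, c i * c j * ∫ ω, X i ω * X j ω ∂P := by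
  have hexpand (ω : Ω) :
      (∑ i, c i * X i ω) ^ 2 = ∑ i, ∑ j, c i * c j * (X i ω * X j ω) := by
    rw [sq, Finset.sum_mul_sum]
    exact Finset.sum_congr rfl fun i _ ↦ Finset.sum_congr rfl fun j _ ↦ by ring
  have hint (i j : T) := (hX.integrable_mul i j).const_mul (c i * c j)
  simp_rw [hexpand, integral_finsetSum _ fun i _ ↦ integrable_finsetSum _ fun j _ ↦ hint i j,
    integral_finsetSum _ fun j _ ↦ hint _ j, integral_const_mul]

theorem charFun_map_toLp [Fintype T] (hX : IsCenteredGaussianProcess X P)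
    (c : EuclideanSpace ℝ T) :
    charFun (P.map fun ω ↦ WithLp.toLp 2 (X · ω)) c
      = Complex.exp (-((∑ i, ∑ j, c i * c j * ∫ ω, X i ω * X j ω ∂P) / 2 : ℝ)) := by
  have hlaw : HasGaussianLaw (fun ω ↦ ∑ i, c i * X i ω) P :=
    (hX.gaussian.smul c).hasGaussianLaw_fun_sum (I := Finset.univ)
  have hcentered : ∫ ω, ∑ i, c i * X i ω ∂P = 0 := by
    rw [integral_finsetSum _ fun i _ ↦ (hX.integrable i).const_mul (c i)]
    simp [integral_const_mul, hX.centered]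
  have hone := charFun_map_of_centered hlaw hcentered 1
  rw [charFun_apply_real, integral_map hlaw.aemeasurable (by fun_prop), hX.integral_sum_sq] at hone
  rw [charFun_apply, integral_map hX.aemeasurable_toLp (by fun_prop)]
  simpa [PiLp.inner_apply] using hone

end

section Covariance

variable {ι Ω Ω' : Type*} [Finite ι] [MeasurableSpace Ω] [MeasurableSpace Ω'] {P : Measure Ω}
  {P' : Measure Ω'} [IsProbabilityMeasure P] [IsProbabilityMeasure P']

theorem tendstoInDistribution_of_tendsto_covariance {X : ℕ → ι → Ω → ℝ} {Y : ι → Ω' → ℝ}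
    (hX : ∀ n, IsCenteredGaussianProcess (X n) P) (hY : IsCenteredGaussianProcess Y P')
    (h : ∀ i j, Tendsto (fun n ↦ ∫ ω, X n i ω * X n j ω ∂P) atTop (𝓝 (∫ ω, Y i ω * Y j ω ∂P'))) :
    TendstoInDistribution (fun n ω i ↦ X n i ω) atTop (fun ω i ↦ Y i ω) (fun _ ↦ P) P' := by
  have := Fintype.ofFinite ι
  have htoLp : TendstoInDistribution (fun n ω ↦ WithLp.toLp 2 (X n · ω)) atTop
      (fun ω ↦ WithLp.toLp 2 (Y · ω)) (fun _ ↦ P) P' :=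
    { forall_aemeasurable n := (hX n).aemeasurable_toLp
      aemeasurable_limit := hY.aemeasurable_toLp
      tendsto := by
        refine ProbabilityMeasure.tendsto_of_tendsto_charFun fun c ↦ ?_
        simp only [ProbabilityMeasure.coe_mk, (hX _).charFun_map_toLp, hY.charFun_map_toLp]
        refine (Complex.continuous_exp.tendsto _).comp <|
          (Complex.continuous_ofReal.neg.tendsto _).comp <| Tendsto.div_const ?_ 2
        exact tendsto_finsetSum _ fun i _ ↦ tendsto_finsetSum _ fun j _ ↦ (h i j).const_mul _ }
  exact htoLp.continuous_comp (PiLp.continuous_ofLp 2 _)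

theorem map_eq_of_covariance_eq {X : ι → Ω → ℝ} {Y : ι → Ω' → ℝ}
    (hX : IsCenteredGaussianProcess X P) (hY : IsCenteredGaussianProcess Y P')
    (h : ∀ i j, ∫ ω, X i ω * X j ω ∂P = ∫ ω, Y i ω * Y j ω ∂P') :
    P.map (fun ω i ↦ X i ω) = P'.map (fun ω i ↦ Y i ω) :=
  tendstoInDistribution_unique (fun (_ : ℕ) ω i ↦ X i ω)
    (tendstoInDistribution_const hX.aemeasurable_pi)
    (tendstoInDistribution_of_tendsto_covariance (fun _ ↦ hX) hY fun i j ↦ by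
      simp_rw [h]; exact tendsto_const_nhds)

theorem sumElim_prod {X : ι → Ω → ℝ} {Y : ι → Ω' → ℝ} (hX : IsCenteredGaussianProcess X P)
    (hY : IsCenteredGaussianProcess Y P') :
    IsCenteredGaussianProcess (Sum.elim (fun i z ↦ X i z.1) fun i z ↦ Y i z.2) (P.prod P') := by
  have := Fintype.ofFinite ι
  have hindep := indepFun_prod₀ hX.aemeasurable_pi hY.aemeasurable_pi
  have hpair : HasGaussianLaw (fun z ↦ ((X · z.1), (Y · z.2))) (P.prod P') := by
    exact hindep.hasGaussianLaw
      (hasGaussianLaw_comp_measurePreserving hX.hasGaussianLaw_pi measurePreserving_fst)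
      (hasGaussianLaw_comp_measurePreserving hY.hasGaussianLaw_pi measurePreserving_snd)
  refine ⟨⟨fun I ↦ ?_⟩, ?_⟩
  · let L : (ι → ℝ) × (ι → ℝ) →L[ℝ] (I → ℝ) := ContinuousLinearMap.pi fun k ↦ k.1.elim
      (fun i ↦ ContinuousLinearMap.proj i ∘L ContinuousLinearMap.fst ℝ (ι → ℝ) (ι → ℝ))
      (fun i ↦ ContinuousLinearMap.proj i ∘L ContinuousLinearMap.snd ℝ (ι → ℝ) (ι → ℝ))
    convert! hpair.map_fun L using 2 with _
    ext k
    rcases k with ⟨i | i, -⟩ <;> rfl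
  · rintro (i | i)
    · simpa [hX.centered] using integral_fun_fst (ν := P') (μ := P) (X i)
    · simpa [hY.centered] using integral_fun_snd (ν := P') (μ := P) (Y i)

theorem tendstoInDistribution_sumElim_of_cross_covariance {X : ι → Ω → ℝ} {Y : ℕ → ι → Ω → ℝ}
    (hXY : ∀ n, IsCenteredGaussianProcess (Sum.elim X (Y n)) P)
    (hcov : ∀ n i j, ∫ ω, Y n i ω * Y n j ω ∂P = ∫ ω, X i ω * X j ω ∂P)
    (hcross : ∀ i j, Tendsto (fun n ↦ ∫ ω, X i ω * Y n j ω ∂P) atTop (𝓝 0)) :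
    TendstoInDistribution (fun n ω k ↦ Sum.elim X (Y n) k ω) atTop
      (fun z k ↦ Sum.elim (fun i z ↦ X i z.1) (fun i z ↦ X i z.2) k z) (fun _ ↦ P)
      (P.prod P) := by
  have hX : IsCenteredGaussianProcess X P := (hXY 0).comp_right Sum.inl
  refine tendstoInDistribution_of_tendsto_covariance hXY (hX.sumElim_prod hX) fun k l ↦ ?_
  rcases k with i | i <;> rcases l with j | j <;> simp only [Sum.elim_inl, Sum.elim_inr]
  · rw [integral_fun_fst fun ω ↦ X i ω * X j ω, probReal_univ, one_smul]
    exact tendsto_const_nhds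
  · rw [integral_prod_mul, hX.centered, zero_mul]
    exact hcross i j
  · simp_rw [mul_comm (X i _), mul_comm (Y _ i _)]
    rw [integral_prod_mul, hX.centered, zero_mul]
    exact hcross j i
  · simp_rw [hcov]
    rw [integral_fun_snd fun ω ↦ X i ω * X j ω, probReal_univ, one_smul]
    exact tendsto_const_nhds

theorem tendsto_integral_mul_of_cross_covariance {X : ι → Ω → ℝ} {Y : ℕ → ι → Ω → ℝ}
    (hXY : ∀ n, IsCenteredGaussianProcess (Sum.elim X (Y n)) P)
    (hcov : ∀ n i j, ∫ ω, Y n i ω * Y n j ω ∂P = ∫ ω, X i ω * X j ω ∂P)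
    (hcross : ∀ i j, Tendsto (fun n ↦ ∫ ω, X i ω * Y n j ω ∂P) atTop (𝓝 0))
    {f : (ι → ℝ) → ℝ} (hf : Continuous f) {C : ℝ} (hfC : ∀ x, |f x| ≤ C) :
    Tendsto (fun n ↦ ∫ ω, f (X · ω) * f (Y n · ω) ∂P) atTop (𝓝 ((∫ ω, f (X · ω) ∂P) ^ 2)) := by
  have hlim := tendstoInDistribution_sumElim_of_cross_covariance hXY hcov hcross
  let F : BoundedContinuousFunction (ι ⊕ ι → ℝ) ℝ :=
    BoundedContinuousFunction.ofNormedAddCommGroup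
      (fun x ↦ f (fun i ↦ x (Sum.inl i)) * f (fun i ↦ x (Sum.inr i)))
      ((hf.comp (by fun_prop)).mul (hf.comp (by fun_prop))) (C * C) fun x ↦ by
        rw [Real.norm_eq_abs, abs_mul]
        exact mul_le_mul (hfC _) (hfC _) (abs_nonneg _) ((abs_nonneg _).trans (hfC 0))
  have hF := ProbabilityMeasure.tendsto_iff_forall_integral_tendsto.1 hlim.tendsto F
  simp only [ProbabilityMeasure.coe_mk,
    integral_map (hlim.forall_aemeasurable _) F.continuous.aestronglyMeasurable,
    integral_map hlim.aemeasurable_limit F.continuous.aestronglyMeasurable] at hF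
  rw [sq, ← integral_prod_mul]
  exact hF

end Covariance

theorem isStationaryProcess {Ω : Type*} [MeasurableSpace Ω] {P : Measure Ω} {X : ℝ → Ω → ℝ}
    (hX : IsCenteredGaussianProcess X P) {r : ℝ → ℝ}
    (hr : ∀ t s, ∫ ω, X t ω * X s ω ∂P = r (t - s)) : IsStationaryProcess X P := fun h I ↦ by
  have := hX.gaussian.isProbabilityMeasure
  have hshift := hX.comp_right fun i : I ↦ (i + h : ℝ)
  have hrestrict := hX.comp_right fun i : I ↦ (i : ℝ)
  refine ⟨hshift.aemeasurable_pi, hrestrict.aemeasurable_pi,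
    hshift.map_eq_of_covariance_eq hrestrict fun i j ↦ ?_⟩
  rw [hr, hr, add_sub_add_right_eq_sub]

end IsCenteredGaussianProcess

theorem exists_version_of_continuous {Ω : Type*} [MeasurableSpace Ω] {P : Measure Ω}
    {X : ℝ → Ω → ℝ} (hX : ∀ t, AEMeasurable (X t) P) {p : (ℝ → ℝ) → Prop} (hp₀ : p fun _ ↦ 0)
    (hp : ∀ g, p g → Continuous g) (h : ∀ᵐ ω ∂P, p (X · ω)) :
    ∃ X' : ℝ → Ω → ℝ, (∀ t, Measurable (X' t)) ∧ (∀ ω, p (X' · ω)) ∧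
      ∀ᵐ ω ∂P, ∀ t, X' t ω = X t ω := by
  have hrat : ∀ᵐ ω ∂P, ∀ q : ℚ, X q ω = (hX q).mk _ ω := ae_all_iff.2 fun q ↦ (hX q).ae_eq_mk
  obtain ⟨G, hGae, hG, hGsub⟩ := (h.and hrat).exists_measurable_mem
  have hgood (ω : Ω) : p (fun t ↦ G.indicator (X t) ω) := by
    by_cases hω : ω ∈ G
    · simpa only [Set.indicator_of_mem hω] using (hGsub ω hω).1
    · simpa only [Set.indicator_of_notMem hω] using hp₀
  refine ⟨fun t ↦ G.indicator (X t), fun t ↦ ?_, hgood, ?_⟩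
  · obtain ⟨x, hx, hxt⟩ := mem_closure_iff_seq_limit.1 (Rat.denseRange_cast (𝕜 := ℝ) t)
    choose q hq using hx
    obtain rfl : (fun n ↦ (q n : ℝ)) = x := funext hq
    refine measurable_of_tendsto_metrizable (fun n ↦ ?_)
      (tendsto_pi_nhds.2 fun ω ↦ ((hp _ (hgood ω)).tendsto t).comp hxt)
    have hind : G.indicator (X (q n)) = G.indicator ((hX (q n)).mk _) :=
      Set.indicator_congr fun ω hω ↦ (hGsub ω hω).2 _
    simpa only [Function.comp_def, hind] using (hX (q n)).measurable_mk.indicator hG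
  · filter_upwards [hGae] with ω hω t using Set.indicator_of_mem hω _

theorem le_of_forall_rat_lt {f g : ℝ → ℝ} (hf : Continuous f) (hg : Continuous g) {a : ℝ}
    (h : ∀ q : ℚ, (q : ℝ) < a → f q ≤ g q) {s : ℝ} (hs : s < a) : f s ≤ g s := by
  have hdense := Rat.denseRange_cast (𝕜 := ℝ) |>.open_subset_closure_inter (isOpen_Iio (a := a))
  refine closure_minimal ?_ (isClosed_le hf hg) (hdense hs)
  rintro _ ⟨hq, q, rfl⟩
  exact h q hq

theorem isSubexponentialPath_of_isBigO_rpow {g : ℝ → ℝ} (hg : Continuous g) {a : ℝ}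
    (h : g =O[atBot] fun s ↦ |s| ^ a) : IsSubexponentialPath g := by
  refine ⟨hg, fun c hc ↦ h.trans ?_⟩
  have hpow := (isLittleO_rpow_exp_pos_mul_atTop a hc).isBigO.comp_tendsto tendsto_neg_atBot_atTop
  refine hpow.congr' ?_ ?_
  · filter_upwards [eventually_le_atBot 0] with s hs
    simp [abs_of_nonpos hs]
  · exact .of_forall fun s ↦ by simp

namespace IsFractionalBrownianMotion

variable {Ω : Type*} [MeasurableSpace Ω] {P : Measure Ω} {H : ℝ} {B : ℝ → Ω → ℝ}

theorem isCenteredGaussianProcess (hB : IsFractionalBrownianMotion H B P) :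
    IsCenteredGaussianProcess B P :=
  ⟨hB.isGaussianProcess, hB.centered⟩

theorem congr (hB : IsFractionalBrownianMotion H B P) {B' : ℝ → Ω → ℝ}
    (h : ∀ t, B t =ᵐ[P] B' t) (hc : ∀ᵐ ω ∂P, Continuous fun t ↦ B' t ω) :
    IsFractionalBrownianMotion H B' P where
  isGaussianProcess := hB.isGaussianProcess.congr h
  centered := (hB.isCenteredGaussianProcess.congr h).centered
  covariance t s := (integral_congr_ae ((h t).mul (h s))).symm.trans (hB.covariance t s)
  continuous_paths := hc

theorem integral_increment_mul_increment (hB : IsFractionalBrownianMotion H B P) (a b c d : ℝ) :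
    ∫ ω, (B a ω - B b ω) * (B c ω - B d ω) ∂P
      = 1 / 2 * (|a - d| ^ (2 * H) + |b - c| ^ (2 * H) - |a - c| ^ (2 * H)
        - |b - d| ^ (2 * H)) := by
  have hint := hB.isCenteredGaussianProcess.integrable_mul
  have hint_sub (x : ℝ) : Integrable (fun ω ↦ B x ω * B c ω - B x ω * B d ω) P :=
    (hint _ _).sub (hint _ _)
  simp_rw [sub_mul, mul_sub (B _ _)]
  rw [integral_sub (hint_sub a) (hint_sub b), integral_sub (hint _ _) (hint _ _),
    integral_sub (hint _ _) (hint _ _)]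
  simp only [hB.covariance]
  ring

theorem integral_increment_sq (hB : IsFractionalBrownianMotion H B P) (hH : 0 < H) (a b : ℝ) :
    ∫ ω, (B a ω - B b ω) ^ 2 ∂P = |a - b| ^ (2 * H) := by
  simp_rw [sq, hB.integral_increment_mul_increment, sub_self, abs_zero, abs_sub_comm b a]
  rw [Real.zero_rpow (by positivity)]
  ring

theorem ae_apply_zero (hB : IsFractionalBrownianMotion H B P) (hH : 0 < H) :
    ∀ᵐ ω ∂P, B 0 ω = 0 := by
  have hsq : ∫ ω, B 0 ω * B 0 ω ∂P = 0 := by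
    simp [hB.covariance, Real.zero_rpow (mul_pos two_pos hH).ne']
  rw [integral_eq_zero_iff_of_nonneg (fun ω ↦ mul_self_nonneg (B 0 ω))
    (hB.isCenteredGaussianProcess.integrable_mul 0 0)] at hsq
  filter_upwards [hsq] with ω hω using mul_self_eq_zero.1 hω

theorem isCenteredGaussianProcess_inversion (hB : IsFractionalBrownianMotion H B P) :
    IsCenteredGaussianProcess (fun t ω ↦ |t| ^ (2 * H) * B t⁻¹ ω) P :=
  (hB.isCenteredGaussianProcess.comp_right (·⁻¹)).const_mul fun t ↦ |t| ^ (2 * H)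

theorem covariance_inversion (hB : IsFractionalBrownianMotion H B P) (hH : 0 < H) (t s : ℝ) :
    ∫ ω, (|t| ^ (2 * H) * B t⁻¹ ω) * (|s| ^ (2 * H) * B s⁻¹ ω) ∂P =
      1 / 2 * (|t| ^ (2 * H) + |s| ^ (2 * H) - |t - s| ^ (2 * H)) := by
  have hH₂ : 2 * H ≠ 0 := by positivity
  rw [integral_congr_ae (.of_forall fun ω ↦ mul_mul_mul_comm _ _ _ _), integral_const_mul,
    hB.covariance]
  rcases eq_or_ne t 0 with rfl | ht
  · simp [Real.zero_rpow hH₂]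
  rcases eq_or_ne s 0 with rfl | hs
  · simp [Real.zero_rpow hH₂]
  have hsub : |t⁻¹ - s⁻¹| = |t - s| / (|t| * |s|) := by
    rw [inv_sub_inv ht hs, abs_div, abs_mul, abs_sub_comm]
  rw [hsub, Real.div_rpow (abs_nonneg _) (by positivity), Real.mul_rpow (abs_nonneg _)
    (abs_nonneg _), abs_inv, abs_inv, Real.inv_rpow (abs_nonneg _), Real.inv_rpow (abs_nonneg _)]
  have ht' := (Real.rpow_pos_of_pos (abs_pos.2 ht) (2 * H)).ne'
  have hs' := (Real.rpow_pos_of_pos (abs_pos.2 hs) (2 * H)).ne'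
  field_simp
  ring

theorem map_inversion_eq (hB : IsFractionalBrownianMotion H B P) (hH : 0 < H) :
    P.map (fun ω (q : ℚ) ↦ |(q : ℝ)| ^ (2 * H) * B (q : ℝ)⁻¹ ω) = P.map fun ω (q : ℚ) ↦ B q ω := by
  have := hB.isGaussianProcess.isProbabilityMeasure
  have hinv := hB.isCenteredGaussianProcess_inversion.comp_right ((↑) : ℚ → ℝ)
  have hrat := hB.isCenteredGaussianProcess.comp_right ((↑) : ℚ → ℝ)
  refine (map_eq_iff_forall_finset_map_restrict_eq hinv.aemeasurable_pi
    hrat.aemeasurable_pi).2 fun I ↦ ?_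
  exact (hinv.comp_right Subtype.val).map_eq_of_covariance_eq (hrat.comp_right Subtype.val)
    fun i j ↦ (hB.covariance_inversion hH i j).trans (hB.covariance i j).symm

-- By time inversion, growth at infinity is continuity at zero.
theorem ae_isBigO_rpow (hB : IsFractionalBrownianMotion H B P) (hH : 0 < H) :
    ∀ᵐ ω ∂P, (fun s ↦ B s ω) =O[atBot] fun s ↦ |s| ^ (2 * H) := by
  have hinv := hB.isCenteredGaussianProcess_inversion.comp_right ((↑) : ℚ → ℝ)
  have hrat := hB.isCenteredGaussianProcess.comp_right ((↑) : ℚ → ℝ)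
  have hmeas : MeasurableSet {x : ℚ → ℝ | Tendsto x (𝓝 0) (𝓝 0)} :=
    measurableSet_tendsto _ fun q ↦ measurable_pi_apply q
  have hlim : ∀ᵐ ω ∂P, Tendsto (fun q : ℚ ↦ |(q : ℝ)| ^ (2 * H) * B (q : ℝ)⁻¹ ω) (𝓝 0) (𝓝 0) := by
    refine (ae_map_iff hinv.aemeasurable_pi hmeas).1 ?_
    rw [hB.map_inversion_eq hH, ae_map_iff hrat.aemeasurable_pi hmeas]
    filter_upwards [hB.continuous_paths, hB.ae_apply_zero hH] with ω hcont hzero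
    have h := (hcont.comp (Rat.continuous_coe_real)).tendsto 0
    simpa only [Function.comp_def, Rat.cast_zero, hzero] using h
  filter_upwards [hlim, hB.continuous_paths] with ω hω hcont
  obtain ⟨δ, hδ, hball⟩ := Metric.eventually_nhds_iff.1 (hω.abs.eventually_le_const
    (abs_zero.trans_lt one_pos))
  have hbound (q : ℚ) (hq : (q : ℝ) < -δ⁻¹) : |B q ω| ≤ |(q : ℝ)| ^ (2 * H) := by
    have hlt : δ⁻¹ < |(q : ℝ)| := (lt_neg.1 hq).trans_le (neg_le_abs _)
    have hpos : 0 < |(q : ℝ)| := (inv_pos.2 hδ).trans hlt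
    have hdist : dist q⁻¹ 0 < δ := by
      rw [← Rat.dist_cast, Rat.cast_zero, dist_zero_right, Rat.cast_inv, norm_inv, Real.norm_eq_abs]
      exact inv_lt_of_inv_lt₀ hδ hlt
    have h := hball hdist
    rw [Rat.cast_inv, inv_inv, abs_mul, abs_inv, abs_of_nonneg (by positivity),
      Real.inv_rpow hpos.le] at h
    rwa [inv_mul_le_iff₀ (by positivity), mul_one] at h
  refine Asymptotics.isBigO_iff.2 ⟨1, (eventually_lt_atBot (-δ⁻¹)).mono fun s hs ↦ ?_⟩
  have hpow : Continuous fun s : ℝ ↦ |s| ^ (2 * H) :=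
    continuous_abs.rpow_const fun _ ↦ .inr (by positivity)
  simpa [abs_of_nonneg (Real.rpow_nonneg (abs_nonneg s) _)] using
    le_of_forall_rat_lt hcont.abs hpow hbound hs

theorem ae_isSubexponentialPath (hB : IsFractionalBrownianMotion H B P) (hH : 0 < H) :
    ∀ᵐ ω ∂P, IsSubexponentialPath (B · ω) := by
  filter_upwards [hB.continuous_paths, hB.ae_isBigO_rpow hH] with ω hcont hgrowth
  exact isSubexponentialPath_of_isBigO_rpow hcont hgrowth

theorem exists_regular_version (hB : IsFractionalBrownianMotion H B P) (hH : 0 < H) :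
    ∃ B' : ℝ → Ω → ℝ, IsFractionalBrownianMotion H B' P ∧ (∀ t, Measurable (B' t)) ∧
      (∀ ω, IsSubexponentialPath (B' · ω)) ∧ ∀ᵐ ω ∂P, ∀ t, B' t ω = B t ω := by
  obtain ⟨B', hmeas, hgood, hae⟩ := exists_version_of_continuous hB.isGaussianProcess.aemeasurable
    ⟨continuous_const, fun c _ ↦ Asymptotics.isBigO_zero _ _⟩ (fun g hg ↦ hg.continuous)
    (hB.ae_isSubexponentialPath hH)
  exact ⟨B', hB.congr (fun t ↦ hae.mono fun ω h ↦ (h t).symm) (.of_forall fun ω ↦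
    (hgood ω).continuous), hmeas, hgood, hae⟩

end IsFractionalBrownianMotion

section ExponentialLaw

variable {θ : ℝ}

theorem expMeasure_eq_withDensity_restrict (θ : ℝ) :
    expMeasure θ = (volume.restrict (Set.Ioi 0)).withDensity
      fun x ↦ ENNReal.ofReal (θ * Real.exp (-θ * x)) := by
  rw [restrict_Ioi_eq_restrict_Ici, ← withDensity_indicator measurableSet_Ici, expMeasure,
    gammaMeasure]
  congr 1 with x
  rcases le_or_gt 0 x with hx | hx
  · rw [Set.indicator_of_mem (Set.mem_Ici.2 hx), gammaPDF_of_nonneg hx]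
    simp
  · rw [Set.indicator_of_notMem (by simpa using hx), gammaPDF_of_neg hx]

theorem ae_pos_expMeasure (θ : ℝ) : ∀ᵐ x ∂expMeasure θ, 0 < x := by
  rw [expMeasure_eq_withDensity_restrict]
  exact withDensity_absolutelyContinuous _ _ (ae_restrict_mem measurableSet_Ioi)

theorem toReal_ofReal_mul_exp_smul {E : Type*} [AddCommGroup E] [Module ℝ E] (hθ : 0 < θ)
    (x : ℝ) (v : E) :
    (ENNReal.ofReal (θ * Real.exp (-θ * x))).toReal • v = θ • Real.exp (-θ * x) • v := by
  rw [ENNReal.toReal_ofReal (by positivity), mul_smul]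

variable {E : Type*} [NormedAddCommGroup E] [NormedSpace ℝ E]

theorem integrable_expMeasure_iff (hθ : 0 < θ) {f : ℝ → E} :
    Integrable f (expMeasure θ) ↔ IntegrableOn (fun x ↦ Real.exp (-θ * x) • f x) (Set.Ioi 0) := by
  rw [expMeasure_eq_withDensity_restrict, integrable_withDensity_iff_integrable_smul'
    (by fun_prop) (.of_forall fun _ ↦ ENNReal.ofReal_lt_top)]
  simp_rw [toReal_ofReal_mul_exp_smul hθ]
  exact integrable_fun_smul_iff hθ.ne' _

theorem integral_expMeasure (hθ : 0 < θ) (f : ℝ → E) :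
    ∫ x, f x ∂expMeasure θ = θ • ∫ x in Set.Ioi 0, Real.exp (-θ * x) • f x := by
  rw [expMeasure_eq_withDensity_restrict, integral_withDensity_eq_integral_toReal_smul
    (by fun_prop) (.of_forall fun _ ↦ ENNReal.ofReal_lt_top)]
  simp_rw [toReal_ofReal_mul_exp_smul hθ]
  exact integral_smul _ _

theorem integral_abs_rpow_expMeasure (hθ : 0 < θ) {a : ℝ} (ha : -1 < a) :
    ∫ x, |x| ^ a ∂expMeasure θ = Real.Gamma (a + 1) / θ ^ a := by
  have hgamma := Real.integral_rpow_mul_exp_neg_mul_Ioi (a := a + 1) (by linarith) hθ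
  have habs : ∫ x in Set.Ioi 0, Real.exp (-θ * x) • |x| ^ a =
      ∫ x in Set.Ioi 0, x ^ (a + 1 - 1) * Real.exp (-(θ * x)) := by
    refine setIntegral_congr_fun measurableSet_Ioi fun x hx ↦ ?_
    simp only [abs_of_pos (Set.mem_Ioi.1 hx), smul_eq_mul, add_sub_cancel_right, neg_mul]
    exact mul_comm _ _
  rw [integral_expMeasure hθ, habs, hgamma, Real.div_rpow zero_le_one hθ.le, Real.one_rpow,
    Real.rpow_add_one hθ.ne', smul_eq_mul]
  field_simp

theorem integral_sq_expMeasure (hθ : 0 < θ) : ∫ x, x ^ 2 ∂expMeasure θ = 2 / θ ^ 2 := by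
  have h := integral_abs_rpow_expMeasure hθ (a := 2) (by norm_num)
  simpa [Real.Gamma_add_one, Real.Gamma_two] using h

theorem charFun_expMeasure (hθ : 0 < θ) (ξ : ℝ) :
    charFun (expMeasure θ) ξ = θ / (θ - ξ * Complex.I) := by
  have hexp (x : ℝ) : Real.exp (-θ * x) • Complex.exp (ξ * x * Complex.I) =
      Complex.exp ((-θ + ξ * Complex.I) * x) := by
    rw [Complex.real_smul, Complex.ofReal_exp, ← Complex.exp_add]
    push_cast
    ring_nf
  rw [charFun_apply_real, integral_expMeasure hθ]
  simp_rw [hexp]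
  rw [integral_exp_mul_complex_Ioi (by simpa using hθ), Complex.real_smul, Complex.ofReal_zero,
    mul_zero, Complex.exp_zero, ← neg_div_neg_eq, neg_neg, neg_add', neg_neg, mul_one_div]

theorem map_sub_expMeasure_prod (hθ : 0 < θ) :
    ((expMeasure θ).prod (expMeasure θ)).map (fun z ↦ z.2 - z.1) =
      (2⁻¹ : NNReal) • (expMeasure θ + (expMeasure θ).map fun x ↦ -x) := by
  have := isProbabilityMeasure_expMeasure hθ
  refine Measure.ext_of_charFun (funext fun ξ ↦ ?_)
  have hleft : charFun (((expMeasure θ).prod (expMeasure θ)).map fun z ↦ z.2 - z.1) ξ =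
      charFun (expMeasure θ) (-ξ) * charFun (expMeasure θ) ξ := by
    simp_rw [charFun_apply_real]
    rw [integral_map (by fun_prop) (by fun_prop), ← integral_prod_mul]
    congr 1 with z
    rw [← Complex.exp_add]
    push_cast
    ring_nf
  have hright : charFun ((2⁻¹ : NNReal) • (expMeasure θ + (expMeasure θ).map fun x ↦ -x)) ξ =
      2⁻¹ * (charFun (expMeasure θ) ξ + charFun (expMeasure θ) (-ξ)) := by
    have hint (μ : Measure ℝ) [IsFiniteMeasure μ] :
        Integrable (fun x : ℝ ↦ Complex.exp (ξ * x * Complex.I)) μ :=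
      .of_bound (by fun_prop) 1 (.of_forall fun x ↦ by
        rw [← Complex.ofReal_mul, Complex.norm_exp_ofReal_mul_I])
    rw [charFun_apply_real, integral_smul_nnreal_measure, integral_add_measure (hint _) (hint _),
      integral_map (by fun_prop) (by fun_prop), NNReal.smul_def, Complex.real_smul]
    simp [charFun_apply_real, -charFun_neg]
  have hne (η : ℝ) : (θ + η * Complex.I : ℂ) ≠ 0 :=
    fun h ↦ hθ.ne' (by simpa using congrArg Complex.re h)
  have hsub := hne (-ξ)
  rw [Complex.ofReal_neg, neg_mul, ← sub_eq_add_neg] at hsub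
  rw [hleft, hright, charFun_expMeasure hθ, charFun_expMeasure hθ, Complex.ofReal_neg, neg_mul,
    sub_neg_eq_add]
  field_simp [hne ξ]
  ring

theorem integrable_map_sub_expMeasure_prod (hθ : 0 < θ) {f : ℝ → ℝ}
    (hf : Integrable f (expMeasure θ)) (hf_neg : Integrable (fun x ↦ f (-x)) (expMeasure θ)) :
    Integrable f (((expMeasure θ).prod (expMeasure θ)).map fun z ↦ z.2 - z.1) := by
  rw [map_sub_expMeasure_prod hθ]
  refine (hf.add_measure ?_).smul_measure_nnreal
  exact (MeasurableEquiv.neg ℝ).measurableEmbedding.integrable_map_iff.2 hf_neg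

theorem integrable_sub_expMeasure_prod (hθ : 0 < θ) {f : ℝ → ℝ} (hf : Integrable f (expMeasure θ))
    (hf_neg : Integrable (fun x ↦ f (-x)) (expMeasure θ)) :
    Integrable (fun z : ℝ × ℝ ↦ f (z.2 - z.1)) ((expMeasure θ).prod (expMeasure θ)) :=
  (integrable_map_sub_expMeasure_prod hθ hf hf_neg).comp_measurable (by fun_prop)

theorem integral_sub_expMeasure_prod (hθ : 0 < θ) {f : ℝ → ℝ} (hf : Integrable f (expMeasure θ))
    (hf_neg : Integrable (fun x ↦ f (-x)) (expMeasure θ)) :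
    ∫ z, f (z.2 - z.1) ∂(expMeasure θ).prod (expMeasure θ) =
      2⁻¹ * (∫ x, f x ∂expMeasure θ + ∫ x, f (-x) ∂expMeasure θ) := by
  have hmap := integrable_map_sub_expMeasure_prod hθ hf hf_neg
  have hf_map_neg : Integrable f ((expMeasure θ).map fun x ↦ -x) :=
    (MeasurableEquiv.neg ℝ).measurableEmbedding.integrable_map_iff.2 hf_neg
  rw [← integral_map (by fun_prop) hmap.aestronglyMeasurable, map_sub_expMeasure_prod hθ,
    integral_smul_nnreal_measure, integral_add_measure hf hf_map_neg, NNReal.smul_def,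
    smul_eq_mul, NNReal.coe_inv, NNReal.coe_two]
  congr 2
  exact (MeasurableEquiv.neg ℝ).measurableEmbedding.integral_map f

end ExponentialLaw

section Autocovariance

variable {H θ : ℝ}

theorem integral_increment_expMeasure_prod (hθ : 0 < θ) {ψ : ℝ → ℝ} {t : ℝ}
    (hadd : Integrable (fun w ↦ ψ (t + w)) (expMeasure θ))
    (hsub : Integrable (fun w ↦ ψ (t - w)) (expMeasure θ)) :
    ∫ z, (ψ (t + z.2) + ψ (t - z.1) - ψ t - ψ (t + (z.2 - z.1)))
      ∂(expMeasure θ).prod (expMeasure θ) =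
      1 / 2 * ∫ w, (ψ (t + w) + ψ (t - w) - 2 * ψ t) ∂expMeasure θ := by
  have := isProbabilityMeasure_expMeasure hθ
  have hsub' : Integrable (fun w ↦ ψ (t + -w)) (expMeasure θ) := by
    simpa only [← sub_eq_add_neg] using hsub
  have hdiff := integrable_sub_expMeasure_prod hθ (f := fun w ↦ ψ (t + w)) hadd hsub'
  have hdiff_eq := integral_sub_expMeasure_prod hθ (f := fun w ↦ ψ (t + w)) hadd hsub'
  have hsnd : Integrable (fun z : ℝ × ℝ ↦ ψ (t + z.2)) ((expMeasure θ).prod (expMeasure θ)) :=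
    hadd.comp_snd _
  have hfst : Integrable (fun z : ℝ × ℝ ↦ ψ (t - z.1)) ((expMeasure θ).prod (expMeasure θ)) :=
    hsub.comp_fst _
  have hsum : Integrable (fun z : ℝ × ℝ ↦ ψ (t + z.2) + ψ (t - z.1) - ψ t)
      ((expMeasure θ).prod (expMeasure θ)) := (hsnd.add hfst).sub (integrable_const _)
  rw [integral_sub hsum hdiff, hdiff_eq,
    integral_sub (hsnd.fun_add hfst) (integrable_const _), integral_add hsnd hfst,
    integral_fun_snd (fun w ↦ ψ (t + w)), integral_fun_fst (fun w ↦ ψ (t - w)),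
    integral_sub (hadd.fun_add hsub) (integrable_const _), integral_add hadd hsub]
  simp only [← sub_eq_add_neg, probReal_univ, integral_const, smul_eq_mul]
  ring

theorem IsSubexponentialPath.integrable_comp_sub_expMeasure {g : ℝ → ℝ}
    (hg : IsSubexponentialPath g) (hθ : 0 < θ) (t : ℝ) :
    Integrable (fun u ↦ g (t - u)) (expMeasure θ) := by
  rw [integrable_expMeasure_iff hθ, ← integrableOn_Ici_iff_integrableOn_Ioi]
  have h := (Measure.measurePreserving_sub_left volume t).integrableOn_comp_preimage
    (MeasurableEquiv.subLeft t).measurableEmbedding |>.2 (hg.integrableOn_exp_mul hθ t t)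
  simpa [Function.comp_def] using h

theorem isSubexponentialPath_abs_rpow {a : ℝ} (ha : 0 ≤ a) :
    IsSubexponentialPath fun s ↦ |s| ^ a :=
  isSubexponentialPath_of_isBigO_rpow (by fun_prop (disch := exact ha))
    (Asymptotics.isBigO_refl _ _)

theorem integrable_abs_sub_rpow_expMeasure (hθ : 0 < θ) {a : ℝ} (ha : 0 ≤ a) (t : ℝ) :
    Integrable (fun w ↦ |t - w| ^ a) (expMeasure θ) :=
  (isSubexponentialPath_abs_rpow ha).integrable_comp_sub_expMeasure hθ t

theorem integrable_abs_add_rpow_expMeasure (hθ : 0 < θ) {a : ℝ} (ha : 0 ≤ a) (t : ℝ) :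
    Integrable (fun w ↦ |t + w| ^ a) (expMeasure θ) := by
  have h := integrable_abs_sub_rpow_expMeasure hθ ha (-t)
  simpa only [← neg_add', abs_neg] using h

theorem integrable_sq_expMeasure (hθ : 0 < θ) : Integrable (fun w ↦ w ^ 2) (expMeasure θ) := by
  simpa using integrable_abs_add_rpow_expMeasure hθ (a := 2) zero_le_two 0

/-- The autocovariance function of the stationary fractional Ornstein–Uhlenbeck process,
`𝔼[Z_{s+t} Z_s]`, as the mean second difference of `|·|^{2H}` at `t` over an exponential step. -/
noncomputable def fouCov (H θ t : ℝ) : ℝ :=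
  1 / 4 * ∫ w, (|t + w| ^ (2 * H) + |t - w| ^ (2 * H) - 2 * |t| ^ (2 * H)) ∂expMeasure θ

theorem fouCov_neg (H θ t : ℝ) : fouCov H θ (-t) = fouCov H θ t := by
  simp only [fouCov, abs_neg, ← neg_add', neg_add_eq_sub, abs_sub_comm _ t,
    add_comm (|t - _| ^ (2 * H))]

theorem fouCov_abs (H θ t : ℝ) : fouCov H θ |t| = fouCov H θ t := by
  rcases abs_choice t with h | h <;> rw [h]
  exact fouCov_neg H θ t

theorem fouCov_zero (hH : 0 < H) (hθ : 0 < θ) :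
    fouCov H θ 0 = H * Real.Gamma (2 * H) / θ ^ (2 * H) := by
  have hH' : 2 * H ≠ 0 := by positivity
  simp only [fouCov, zero_add, zero_sub, abs_neg, abs_zero, Real.zero_rpow hH', mul_zero, sub_zero,
    ← two_mul]
  rw [integral_const_mul, integral_abs_rpow_expMeasure hθ (by linarith), Real.Gamma_add_one hH']
  ring

theorem integral_expMeasure_indicator_Ioi (hθ : 0 < θ) {t : ℝ} (ht : 0 ≤ t) (f : ℝ → ℝ) :
    ∫ w, (Set.Ioi t).indicator f w ∂expMeasure θ =
      Real.exp (-θ * t) * ∫ w, f (t + w) ∂expMeasure θ := by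
  have hexp (w : ℝ) : Real.exp (-θ * t) * (Real.exp (-θ * w) * f (t + w)) =
      Real.exp (-θ * (t + w)) * f (t + w) := by
    rw [mul_add, Real.exp_add, mul_assoc]
  have hshift := (measurePreserving_add_left volume t).setIntegral_preimage_emb
    (measurableEmbedding_addLeft t) (fun w ↦ Real.exp (-θ * w) * f w) (Set.Ioi t)
  have hindicator (w : ℝ) : Real.exp (-θ * w) * (Set.Ioi t).indicator f w =
      (Set.Ioi t).indicator (fun w ↦ Real.exp (-θ * w) * f w) w :=
    (Set.indicator_mul_right _ (fun w ↦ Real.exp (-θ * w)) _).symm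
  simp only [integral_expMeasure hθ, smul_eq_mul, hindicator]
  rw [setIntegral_indicator measurableSet_Ioi, Set.inter_eq_right.2 (Set.Ioi_subset_Ioi ht),
    ← hshift, mul_left_comm, ← integral_const_mul (Real.exp (-θ * t))]
  simp only [hexp, Set.preimage_const_add_Ioi, sub_self]

theorem fouCov_half (hθ : 0 < θ) {t : ℝ} (ht : 0 ≤ t) :
    fouCov (1 / 2) θ t = Real.exp (-θ * t) / (2 * θ) := by
  have hdiff : ∀ᵐ w ∂expMeasure θ, |t + w| ^ (2 * (1 / 2) : ℝ) + |t - w| ^ (2 * (1 / 2) : ℝ) -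
      2 * |t| ^ (2 * (1 / 2) : ℝ) = (Set.Ioi t).indicator (fun w ↦ 2 * |w - t| ^ (1 : ℝ)) w := by
    filter_upwards [ae_pos_expMeasure θ] with w hw
    rw [mul_one_div_cancel two_ne_zero]
    simp only [Real.rpow_one, abs_of_nonneg ht, abs_of_nonneg (add_nonneg ht hw.le)]
    rcases lt_or_ge t w with htw | htw
    · rw [Set.indicator_of_mem (Set.mem_Ioi.2 htw), abs_of_neg (sub_neg.2 htw),
        abs_of_pos (sub_pos.2 htw)]
      ring
    · rw [Set.indicator_of_notMem (by simpa using htw), abs_of_nonneg (sub_nonneg.2 htw)]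
      ring
  rw [fouCov, integral_congr_ae hdiff, integral_expMeasure_indicator_Ioi hθ ht]
  simp only [add_sub_cancel_left]
  rw [integral_const_mul, integral_abs_rpow_expMeasure hθ (by norm_num), Real.rpow_one,
    one_add_one_eq_two, Real.Gamma_two]
  ring

theorem hasDerivAt_const_add_rpow (b : ℝ) {x : ℝ} (hx : 0 < 1 + x) :
    HasDerivAt (fun x : ℝ ↦ (1 + x) ^ b) (b * (1 + x) ^ (b - 1)) x := by
  simpa using ((hasDerivAt_id x).const_add 1).rpow_const (p := b) (Or.inl hx.ne')

theorem hasDerivAt_const_sub_rpow (b : ℝ) {x : ℝ} (hx : 0 < 1 - x) :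
    HasDerivAt (fun x : ℝ ↦ (1 - x) ^ b) (-(b * (1 - x) ^ (b - 1))) x := by
  simpa using ((hasDerivAt_id x).const_sub 1).rpow_const (p := b) (Or.inl hx.ne')

theorem tendsto_first_difference_rpow (a : ℝ) :
    Tendsto (fun x : ℝ ↦ (a * (1 + x) ^ (a - 1) - a * (1 - x) ^ (a - 1)) / (2 * x)) (𝓝[≠] 0)
      (𝓝 (a * (a - 1))) := by
  have hderiv := ((hasDerivAt_const_add_rpow (a - 1) (x := 0) (by norm_num)).sub
    (hasDerivAt_const_sub_rpow (a - 1) (x := 0) (by norm_num))).const_mul (a / 2)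
  convert hderiv.tendsto_slope_zero using 2 with x
  · simp
    field_simp
  · norm_num
    ring

theorem tendsto_second_difference_rpow (a : ℝ) :
    Tendsto (fun x : ℝ ↦ ((1 + x) ^ a + (1 - x) ^ a - 2) / x ^ 2) (𝓝[≠] 0) (𝓝 (a * (a - 1))) := by
  have hderiv {x : ℝ} (hx : x ∈ Set.Ioo (-1) 1) :
      HasDerivAt (fun x : ℝ ↦ (1 + x) ^ a + (1 - x) ^ a - 2)
        (a * (1 + x) ^ (a - 1) - a * (1 - x) ^ (a - 1)) x := by
    simpa [sub_eq_add_neg] using ((hasDerivAt_const_add_rpow a (by linarith [hx.1])).add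
      (hasDerivAt_const_sub_rpow a (by linarith [hx.2]))).sub_const 2
  refine HasDerivAt.lhopital_zero_nhdsNE
    (eventually_nhdsWithin_of_eventually_nhds ?_)
    (.of_forall fun x ↦ by simpa using hasDerivAt_pow 2 x) ?_ ?_ ?_
    (tendsto_first_difference_rpow a)
  · filter_upwards [Ioo_mem_nhds (neg_one_lt_zero (R := ℝ)) one_pos] with x hx using hderiv hx
  · filter_upwards [self_mem_nhdsWithin] with x hx
    simpa using hx
  · have h := (hderiv (x := 0) (by norm_num)).continuousAt.tendsto
    norm_num at h
    exact h.mono_left nhdsWithin_le_nhds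
  · have h := (continuous_pow 2 (M := ℝ)).tendsto 0
    rw [zero_pow two_ne_zero] at h
    exact h.mono_left nhdsWithin_le_nhds

theorem tendsto_second_difference_abs_rpow (a : ℝ) :
    Tendsto (fun x : ℝ ↦ (|1 + x| ^ a + |1 - x| ^ a - 2) / x ^ 2) (𝓝[≠] 0)
      (𝓝 (a * (a - 1))) := by
  refine (tendsto_second_difference_rpow a).congr' (eventually_nhdsWithin_of_eventually_nhds ?_)
  filter_upwards [Ioo_mem_nhds (neg_one_lt_zero (R := ℝ)) one_pos] with x hx
  rw [abs_of_pos (by linarith [hx.1] : 0 < 1 + x), abs_of_pos (by linarith [hx.2] : 0 < 1 - x)]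

theorem abs_rpow_le_one_add_sq {a : ℝ} (ha0 : 0 ≤ a) (ha2 : a ≤ 2) (x : ℝ) :
    |x| ^ a ≤ 1 + x ^ 2 := by
  rcases le_or_gt |x| 1 with hx | hx
  · linarith [Real.rpow_le_one (abs_nonneg x) hx ha0, sq_nonneg x]
  · have h := Real.rpow_le_rpow_of_exponent_le hx.le ha2
    rw [Real.rpow_two, sq_abs] at h
    linarith

theorem exists_abs_second_difference_rpow_le {a : ℝ} (ha0 : 0 ≤ a) (ha2 : a ≤ 2) :
    ∃ C, 0 ≤ C ∧ ∀ x : ℝ, |(|1 + x| ^ a + |1 - x| ^ a - 2)| ≤ C * x ^ 2 := by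
  have hnear := (tendsto_second_difference_abs_rpow a).abs.eventually_le_const
    (lt_add_one |a * (a - 1)|)
  obtain ⟨δ, hδ, hball⟩ := Metric.mem_nhdsWithin_iff.1 hnear
  refine ⟨(|a * (a - 1)| + 1) + (2 + 6 / δ ^ 2), by positivity, fun x ↦ ?_⟩
  rcases eq_or_ne x 0 with rfl | hx0
  · norm_num
  rcases lt_or_ge |x| δ with hx | hx
  · have hratio := hball ⟨by simpa using hx, hx0⟩
    rw [Set.mem_ofPred_eq, abs_div, abs_of_nonneg (sq_nonneg x),
      div_le_iff₀ (by positivity)] at hratio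
    refine hratio.trans (mul_le_mul_of_nonneg_right ?_ (sq_nonneg x))
    linarith [show 0 ≤ 2 + 6 / δ ^ 2 by positivity]
  · have hfar : 6 ≤ 6 / δ ^ 2 * x ^ 2 := by
      have hsq : δ ^ 2 ≤ x ^ 2 := by
        rw [← sq_abs x]
        gcongr
      rw [div_mul_eq_mul_div, le_div_iff₀ (by positivity)]
      linarith
    have hadd := abs_rpow_le_one_add_sq ha0 ha2 (1 + x)
    have hsub := abs_rpow_le_one_add_sq ha0 ha2 (1 - x)
    have hadd_nonneg := Real.rpow_nonneg (abs_nonneg (1 + x)) a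
    have hsub_nonneg := Real.rpow_nonneg (abs_nonneg (1 - x)) a
    have hnonneg : 0 ≤ (|a * (a - 1)| + 1) * x ^ 2 := by positivity
    rw [abs_le]
    constructor <;> nlinarith

theorem second_difference_rpow_eq (a : ℝ) {t : ℝ} (ht : 0 < t) (w : ℝ) :
    |t + w| ^ a + |t - w| ^ a - 2 * |t| ^ a =
      t ^ (a - 2) * (t ^ 2 * (|1 + w / t| ^ a + |1 - w / t| ^ a - 2)) := by
  have hadd : t + w = t * (1 + w / t) := by field_simp
  have hsub : t - w = t * (1 - w / t) := by field_simp
  have hpow : t ^ (a - 2) * t ^ 2 = t ^ a := by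
    rw [← Real.rpow_two, ← Real.rpow_add ht, sub_add_cancel]
  rw [← mul_assoc, hpow, hadd, hsub, abs_mul, abs_mul, Real.mul_rpow (abs_nonneg _) (abs_nonneg _),
    Real.mul_rpow (abs_nonneg _) (abs_nonneg _), abs_of_pos ht]
  ring

theorem fouCov_eq_rpow_mul (H θ : ℝ) {t : ℝ} (ht : 0 < t) :
    fouCov H θ t = t ^ (2 * H - 2) *
      (1 / 4 * ∫ w, t ^ 2 * (|1 + w / t| ^ (2 * H) + |1 - w / t| ^ (2 * H) - 2) ∂expMeasure θ) := by
  simp_rw [fouCov, second_difference_rpow_eq _ ht]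
  rw [integral_const_mul, mul_left_comm]

theorem exists_abs_sq_mul_second_difference_rpow_le (hH₀ : 0 < H) (hH₁ : H < 1) :
    ∃ C, 0 ≤ C ∧ ∀ t > 0, ∀ w : ℝ,
      |t ^ 2 * (|1 + w / t| ^ (2 * H) + |1 - w / t| ^ (2 * H) - 2)| ≤ C * w ^ 2 := by
  obtain ⟨C, hC0, hC⟩ := exists_abs_second_difference_rpow_le (a := 2 * H) (by linarith)
    (by linarith)
  refine ⟨C, hC0, fun t ht w ↦ ?_⟩
  rw [abs_mul, abs_of_pos (pow_pos ht 2)]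
  calc t ^ 2 * |(|1 + w / t| ^ (2 * H) + |1 - w / t| ^ (2 * H) - 2)|
      ≤ t ^ 2 * (C * (w / t) ^ 2) := by gcongr; exact hC _
    _ = C * w ^ 2 := by field_simp

theorem exists_abs_fouCov_le (hH₀ : 0 < H) (hH₁ : H < 1) (hθ : 0 < θ) :
    ∃ K, 0 ≤ K ∧ ∀ t > 0, |fouCov H θ t| ≤ K * t ^ (2 * H - 2) := by
  obtain ⟨C, hC0, hC⟩ := exists_abs_sq_mul_second_difference_rpow_le hH₀ hH₁
  refine ⟨1 / 4 * (C * (2 / θ ^ 2)), by positivity, fun t ht ↦ ?_⟩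
  have hint : ‖∫ w, t ^ 2 * (|1 + w / t| ^ (2 * H) + |1 - w / t| ^ (2 * H) - 2) ∂expMeasure θ‖ ≤
      ∫ w, C * w ^ 2 ∂expMeasure θ :=
    norm_integral_le_of_norm_le ((integrable_sq_expMeasure hθ).const_mul C) (.of_forall (hC t ht))
  rw [integral_const_mul C, integral_sq_expMeasure hθ, Real.norm_eq_abs] at hint
  rw [fouCov_eq_rpow_mul H θ ht, abs_mul, abs_mul, abs_of_pos (Real.rpow_pos_of_pos ht _), mul_comm,
    abs_of_pos (one_div_pos.2 four_pos)]
  gcongr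

theorem tendsto_fouCov_atTop (hH₀ : 0 < H) (hH₁ : H < 1) (hθ : 0 < θ) :
    Tendsto (fouCov H θ) atTop (𝓝 0) := by
  obtain ⟨K, -, hK⟩ := exists_abs_fouCov_le hH₀ hH₁ hθ
  have hbound : Tendsto (fun t : ℝ ↦ K * t ^ (2 * H - 2)) atTop (𝓝 0) := by
    simpa using (tendsto_rpow_neg_atTop (y := 2 - 2 * H) (by linarith)).const_mul K
  refine squeeze_zero_norm' ?_ hbound
  filter_upwards [eventually_gt_atTop 0] with t ht using hK t ht

theorem tendsto_sq_mul_second_difference_rpow (a : ℝ) {w : ℝ} (hw : 0 < w) :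
    Tendsto (fun t : ℝ ↦ t ^ 2 * (|1 + w / t| ^ a + |1 - w / t| ^ a - 2)) atTop
      (𝓝 (a * (a - 1) * w ^ 2)) := by
  have hdiv : Tendsto (fun t : ℝ ↦ w / t) atTop (𝓝[≠] 0) := by
    refine tendsto_nhdsWithin_iff.2 ⟨tendsto_id.const_div_atTop w, ?_⟩
    filter_upwards [eventually_gt_atTop 0] with t ht using (div_pos hw ht).ne'
  refine (((tendsto_second_difference_abs_rpow a).comp hdiv).mul_const (w ^ 2)).congr' ?_
  filter_upwards [eventually_gt_atTop 0] with t ht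
  simp only [Function.comp_apply]
  field_simp

theorem tendsto_fouCov_div_rpow (hH₀ : 0 < H) (hH₁ : H < 1) (hθ : 0 < θ) :
    Tendsto (fun t ↦ fouCov H θ t / t ^ (2 * H - 2)) atTop
      (𝓝 (H * (2 * H - 1) / θ ^ 2)) := by
  obtain ⟨C, -, hC⟩ := exists_abs_sq_mul_second_difference_rpow_le hH₀ hH₁
  have hlim : Tendsto (fun t : ℝ ↦ ∫ w,
      t ^ 2 * (|1 + w / t| ^ (2 * H) + |1 - w / t| ^ (2 * H) - 2) ∂expMeasure θ) atTop
      (𝓝 (∫ w, 2 * H * (2 * H - 1) * w ^ 2 ∂expMeasure θ)) := by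
    refine tendsto_integral_filter_of_dominated_convergence (fun w ↦ C * w ^ 2) ?_ ?_
      ((integrable_sq_expMeasure hθ).const_mul C) ?_
    · exact .of_forall fun t ↦ by fun_prop
    · filter_upwards [eventually_gt_atTop 0] with t ht using .of_forall (hC t ht)
    · filter_upwards [ae_pos_expMeasure θ] with w hw
        using tendsto_sq_mul_second_difference_rpow (2 * H) hw
  rw [integral_const_mul, integral_sq_expMeasure hθ] at hlim
  convert (hlim.const_mul (1 / 4)).congr' ?_ using 2
  · ring
  · filter_upwards [eventually_gt_atTop 0] with t ht
    rw [fouCov_eq_rpow_mul H θ ht, mul_div_cancel_left₀ _ (Real.rpow_pos_of_pos ht _).ne']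

end Autocovariance

theorem fouZ_eq_integral_expMeasure {Ω : Type*} {θ : ℝ} {B : ℝ → Ω → ℝ} {ω : Ω}
    (hpath : IsSubexponentialPath (B · ω)) (hθ : 0 < θ) (t : ℝ) :
    fouZ θ B t ω = ∫ u, (B t ω - B (t - u) ω) ∂expMeasure θ := by
  rw [fouZ, (hpath.hasRSIntegralIic_exp_sub_increment hθ t).rsIntegralIic_eq,
    integral_expMeasure hθ]
  simp only [smul_eq_mul]

section StationaryProcess

variable {Ω T : Type*} [MeasurableSpace Ω] {P : Measure Ω} {H θ : ℝ}

theorem measurable_increment {B : ℝ → Ω → ℝ} (hmeas : ∀ t, Measurable (B t))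
    (hcont : ∀ ω, Continuous (B · ω)) (t : ℝ) :
    Measurable fun z : Ω × ℝ ↦ B t z.1 - B (t - z.2) z.1 :=
  have hjoint : Measurable (Function.uncurry B) :=
    measurable_uncurry_of_continuous_of_measurable hcont hmeas
  ((hmeas t).comp measurable_fst).sub
    (hjoint.comp ((measurable_const.sub measurable_snd).prodMk measurable_fst))

theorem measurable_fouZ {B : ℝ → Ω → ℝ} (hmeas : ∀ t, Measurable (B t))
    (hpath : ∀ ω, IsSubexponentialPath (B · ω)) (hθ : 0 < θ) (t : ℝ) :
    Measurable (fouZ θ B t) := by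
  have := isProbabilityMeasure_expMeasure hθ
  rw [funext fun ω ↦ fouZ_eq_integral_expMeasure (hpath ω) hθ t]
  exact (measurable_increment hmeas
    (fun ω ↦ (hpath ω).continuous) t).stronglyMeasurable.integral_prod_right.measurable

theorem IsCenteredGaussianProcess.of_hasRSIntegral {B : ℝ → Ω → ℝ}
    (hB : IsCenteredGaussianProcess B P) {f : T → ℝ → ℝ} {a b : T → ℝ} {I : T → Ω → ℝ}
    (hI : ∀ t ω, HasRSIntegral (f t) (fun s ↦ B s ω) (a t) (b t) (I t ω)) :
    IsCenteredGaussianProcess I P := by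
  classical
  have := hB.gaussian.isProbabilityMeasure
  refine .of_ae_tendsto (fun n ↦ hB.of_forall_clm fun t ↦ ?_)
    fun t ↦ .of_forall fun ω ↦ (hI t ω).tendsto_sum_uniform
  set x : ℕ → ℝ := fun i ↦ a t + i * ((b t - a t) / n) with hx
  have hmem {i : ℕ} (hi : i < n + 1) : x i ∈ (Finset.range (n + 1)).image x :=
    Finset.mem_image_of_mem x (Finset.mem_range.2 hi)
  refine ⟨(Finset.range (n + 1)).image x, ∑ i : Fin n, f t (x i) •
    (ContinuousLinearMap.proj ⟨x (i + 1), hmem (by lia)⟩ -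
      ContinuousLinearMap.proj ⟨x i, hmem (by lia)⟩), fun ω ↦ ?_⟩
  rw [Finset.sum_range]
  simp [hx]

theorem isCenteredGaussianProcess_fouZ_of_isSubexponentialPath {B : ℝ → Ω → ℝ}
    (hB : IsCenteredGaussianProcess B P) (hpath : ∀ ω, IsSubexponentialPath (B · ω)) (hθ : 0 < θ) :
    IsCenteredGaussianProcess (fouZ θ B) P := by
  have := hB.gaussian.isProbabilityMeasure
  refine .of_ae_tendsto (Y := fun n t ω ↦
    rsIntegral (fun s ↦ Real.exp (-θ * (t - s))) (fun s ↦ B s ω) (min (-n) t) t) (fun n ↦ ?_)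
    fun t ↦ .of_forall fun ω ↦ ?_
  · refine hB.of_hasRSIntegral (f := fun t s ↦ Real.exp (-θ * (t - s))) (a := fun t ↦ min (-n) t)
      (b := id) fun t ω ↦ ?_
    have h := hasRSIntegral_exp_sub θ t (min_le_right (-(n : ℝ)) t)
      (hpath ω).continuous.continuousOn
    rwa [h.rsIntegral_eq]
  · have h := (hpath ω).hasRSIntegralIic_exp_sub hθ t t
    rw [fouZ, h.rsIntegralIic_eq]
    exact h.2.comp (tendsto_atBot_mono (fun n : ℕ ↦ min_le_left (-(n : ℝ)) t)
      (tendsto_neg_atTop_atBot.comp tendsto_natCast_atTop_atTop))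

theorem integral_integral_mul_integral {α : Type*} [MeasurableSpace α] [SFinite P] {ν : Measure α}
    [IsProbabilityMeasure ν] {Y₁ Y₂ : Ω × α → ℝ} (h₁ : MemLp Y₁ 2 (P.prod ν))
    (h₂ : MemLp Y₂ 2 (P.prod ν)) :
    ∫ ω, (∫ u, Y₁ (ω, u) ∂ν) * ∫ v, Y₂ (ω, v) ∂ν ∂P =
      ∫ z, ∫ ω, Y₁ (ω, z.1) * Y₂ (ω, z.2) ∂P ∂ν.prod ν := by
  have hint : Integrable (fun z : Ω × α × α ↦ Y₁ (z.1, z.2.1) * Y₂ (z.1, z.2.2))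
      (P.prod (ν.prod ν)) :=
    (h₁.comp_measurePreserving ((MeasurePreserving.id P).prod measurePreserving_fst)).integrable_mul
      (h₂.comp_measurePreserving ((MeasurePreserving.id P).prod measurePreserving_snd))
  simp_rw [← integral_prod_mul]
  exact integral_integral_swap hint

theorem memLp_two_of_integral_sq {α : Type*} [MeasurableSpace α] [SFinite P] {ν : Measure α}
    [SFinite ν] {Y : Ω × α → ℝ} (hY : AEStronglyMeasurable Y (P.prod ν))
    (hYω : ∀ u, MemLp (fun ω ↦ Y (ω, u)) 2 P) (hsq : Integrable (fun u ↦ ∫ ω, Y (ω, u) ^ 2 ∂P) ν) :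
    MemLp Y 2 (P.prod ν) := by
  refine (memLp_two_iff_integrable_sq hY).2 ((integrable_prod_iff' (hY.pow 2)).2
    ⟨.of_forall fun u ↦ (hYω u).integrable_sq, ?_⟩)
  simpa using hsq

namespace IsFractionalBrownianMotion

variable {B : ℝ → Ω → ℝ}

theorem memLp_two_increment (hB : IsFractionalBrownianMotion H B P) (hH : 0 < H)
    (hmeas : ∀ t, Measurable (B t)) (hcont : ∀ ω, Continuous (B · ω)) (hθ : 0 < θ) (t : ℝ) :
    MemLp (fun z : Ω × ℝ ↦ B t z.1 - B (t - z.2) z.1) 2 (P.prod (expMeasure θ)) := by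
  have := hB.isGaussianProcess.isProbabilityMeasure
  have := isProbabilityMeasure_expMeasure hθ
  refine memLp_two_of_integral_sq (measurable_increment hmeas hcont t).aestronglyMeasurable
    (fun u ↦ (hB.isCenteredGaussianProcess.memLp_two t).sub
      (hB.isCenteredGaussianProcess.memLp_two (t - u))) ?_
  simp only [hB.integral_increment_sq hH, sub_sub_cancel]
  simpa using integrable_abs_add_rpow_expMeasure hθ (a := 2 * H) (by positivity) 0

theorem integral_fouZ_mul_fouZ_of_regular (hB : IsFractionalBrownianMotion H B P) (hH : 0 < H)
    (hmeas : ∀ t, Measurable (B t)) (hpath : ∀ ω, IsSubexponentialPath (B · ω)) (hθ : 0 < θ)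
    (t s : ℝ) : ∫ ω, fouZ θ B t ω * fouZ θ B s ω ∂P = fouCov H θ (t - s) := by
  have := hB.isGaussianProcess.isProbabilityMeasure
  have := isProbabilityMeasure_expMeasure hθ
  have hLp := hB.memLp_two_increment hH hmeas (fun ω ↦ (hpath ω).continuous) hθ
  have hcov (u v : ℝ) : ∫ ω, (B t ω - B (t - u) ω) * (B s ω - B (s - v) ω) ∂P =
      1 / 2 * (|t - s + v| ^ (2 * H) + |t - s - u| ^ (2 * H) - |t - s| ^ (2 * H) -
        |t - s + (v - u)| ^ (2 * H)) := by
    rw [hB.integral_increment_mul_increment]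
    ring_nf
  simp_rw [fun ω ↦ fouZ_eq_integral_expMeasure (hpath ω) hθ]
  rw [integral_integral_mul_integral (hLp t) (hLp s)]
  simp_rw [hcov]
  rw [integral_const_mul, integral_increment_expMeasure_prod hθ (ψ := fun x ↦ |x| ^ (2 * H))
    (integrable_abs_add_rpow_expMeasure hθ (by positivity) _)
    (integrable_abs_sub_rpow_expMeasure hθ (by positivity) _), fouCov]
  ring

end IsFractionalBrownianMotion

end StationaryProcess

section Ergodicity

variable {Ω : Type*} [MeasurableSpace Ω] {P : Measure Ω}

theorem exists_continuous_integral_abs_indicator_sub_le {ι : Type*} [Finite ι]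
    (ν : Measure (ι → ℝ)) [IsFiniteMeasure ν] {S : Set (ι → ℝ)} (hS : MeasurableSet S) {ε : ℝ}
    (hε : 0 < ε) :
    ∃ f : (ι → ℝ) → ℝ, Continuous f ∧ (∀ x, |f x| ≤ 1) ∧ ∫ x, |S.indicator 1 x - f x| ∂ν ≤ ε := by
  have := Fintype.ofFinite ι
  have hint : Integrable (S.indicator (1 : (ι → ℝ) → ℝ)) ν :=
    (integrable_const (1 : ℝ)).indicator hS
  obtain ⟨g, hg, hgint⟩ := hint.exists_boundedContinuous_integral_sub_le hε
  let clamp (y : ℝ) : ℝ := Set.projIcc 0 1 zero_le_one y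
  have hclamp (x : ι → ℝ) : |S.indicator 1 x - clamp (g x)| ≤ |S.indicator 1 x - g x| := by
    have hmem : S.indicator (1 : (ι → ℝ) → ℝ) x ∈ Set.Icc (0 : ℝ) 1 :=
      ⟨Set.indicator_nonneg (fun _ _ ↦ zero_le_one) x,
        Set.indicator_le_self' (fun _ _ ↦ zero_le_one) x⟩
    simpa [clamp, Set.projIcc_of_mem zero_le_one hmem] using
      Set.abs_projIcc_sub_projIcc (c := S.indicator 1 x) (d := g x) (zero_le_one (α := ℝ))
  refine ⟨fun x ↦ clamp (g x), (continuous_subtype_val.comp continuous_projIcc).comp g.continuous,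
    fun x ↦ abs_le.2 ⟨by linarith [(Set.projIcc 0 1 zero_le_one (g x)).2.1],
      (Set.projIcc 0 1 zero_le_one (g x)).2.2⟩, le_trans ?_ hg⟩
  exact integral_mono_of_nonneg (.of_forall fun x ↦ abs_nonneg _) (hint.sub hgint).abs
    (.of_forall hclamp)

theorem exists_cylinder_integral_abs_indicator_sub_le {T : Type*} (μ : Measure (T → ℝ))
    [IsFiniteMeasure μ] {A : Set (T → ℝ)} (hA : MeasurableSet A) {ε : ℝ} (hε : 0 < ε) :
    ∃ (I : Finset T) (S : Set (I → ℝ)), MeasurableSet S ∧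
      ∫ x, |A.indicator 1 x - (cylinder I S).indicator 1 x| ∂μ ≤ ε := by
  obtain ⟨s, hs, hsε⟩ := (Measure.MeasureDense.of_generateFrom_isSetAlgebra_finite (μ := μ)
    isSetAlgebra_measurableCylinders generateFrom_measurableCylinders.symm).approx A hA
    (measure_ne_top _ _) ε hε
  obtain ⟨I, S, hS, rfl⟩ := (mem_measurableCylinders s).1 hs
  refine ⟨I, S, hS, ?_⟩
  have hsymmDiff : (fun x ↦ |A.indicator (1 : (T → ℝ) → ℝ) x - (cylinder I S).indicator 1 x|) =
      (symmDiff A (cylinder I S)).indicator 1 := by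
    ext x
    by_cases h₁ : x ∈ A <;> by_cases h₂ : x ∈ cylinder I S <;> simp [h₁, h₂, Set.mem_symmDiff]
  rw [hsymmDiff, integral_indicator_one (hA.symmDiff (.of_mem_measurableCylinders hs))]
  exact ENNReal.toReal_le_of_le_ofReal hε.le hsε.le

theorem exists_continuous_restrict_integral_abs_indicator_sub_le {T : Type*}
    (μ : Measure (T → ℝ)) [IsFiniteMeasure μ] {A : Set (T → ℝ)} (hA : MeasurableSet A) {ε : ℝ}
    (hε : 0 < ε) :
    ∃ (I : Finset T) (f : (I → ℝ) → ℝ), Continuous f ∧ (∀ x, |f x| ≤ 1) ∧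
      ∫ x, |A.indicator 1 x - f (I.restrict x)| ∂μ ≤ ε := by
  obtain ⟨I, S, hS, hAS⟩ := exists_cylinder_integral_abs_indicator_sub_le μ hA (half_pos hε)
  obtain ⟨f, hf, hf₁, hfS⟩ := exists_continuous_integral_abs_indicator_sub_le
    (μ.map I.restrict) hS (half_pos hε)
  have hrestrict : Measurable (I.restrict (π := fun _ : T ↦ ℝ)) := Finset.measurable_restrict _
  have hfint : Integrable (fun x : T → ℝ ↦ f (I.restrict x)) μ :=
    .of_bound (hf.measurable.comp hrestrict).aestronglyMeasurable 1 (.of_forall fun x ↦ hf₁ _)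
  have hindicator {s : Set (T → ℝ)} (hs : MeasurableSet s) :
      Integrable (s.indicator (1 : (T → ℝ) → ℝ)) μ := (integrable_const (1 : ℝ)).indicator hs
  have hdist : Measurable fun x ↦ |S.indicator 1 x - f x| :=
    ((measurable_one.indicator hS).sub hf.measurable).abs
  rw [integral_map hrestrict.aemeasurable hdist.aestronglyMeasurable] at hfS
  have hAC := ((hindicator hA).sub (hindicator (hS.cylinder I))).abs
  have hCf := ((hindicator (hS.cylinder I)).sub hfint).abs
  refine ⟨I, f, hf, hf₁, ?_⟩
  calc ∫ x, |A.indicator 1 x - f (I.restrict x)| ∂μ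
      ≤ ∫ x, (|A.indicator 1 x - (cylinder I S).indicator 1 x| +
          |(cylinder I S).indicator 1 x - f (I.restrict x)|) ∂μ :=
        integral_mono ((hindicator hA).sub hfint).abs (hAC.add hCf) fun x ↦ abs_sub_le _ _ _
    _ = _ := integral_add hAC hCf
    _ ≤ ε / 2 + ε / 2 := add_le_add hAS hfS
    _ = ε := add_halves ε

theorem abs_integral_mul_sub_measureReal_le [IsFiniteMeasure P] {A : Set Ω}
    (hA : MeasurableSet A) {u v : Ω → ℝ} (hu : AEStronglyMeasurable u P)
    (hv : AEStronglyMeasurable v P) (hu₁ : ∀ ω, |u ω| ≤ 1) (hv₁ : ∀ ω, |v ω| ≤ 1) :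
    |∫ ω, u ω * v ω ∂P - P.real A| ≤
      ∫ ω, |A.indicator 1 ω - u ω| ∂P + ∫ ω, |A.indicator 1 ω - v ω| ∂P := by
  have hAint : Integrable (A.indicator (1 : Ω → ℝ)) P := (integrable_const (1 : ℝ)).indicator hA
  have huint : Integrable u P := .of_bound hu 1 (.of_forall hu₁)
  have hvint : Integrable v P := .of_bound hv 1 (.of_forall hv₁)
  have huv : Integrable (fun ω ↦ u ω * v ω) P := hvint.bdd_mul hu (.of_forall hu₁)
  have hpointwise (ω : Ω) : |u ω * v ω - A.indicator 1 ω| ≤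
      |A.indicator 1 ω - u ω| + |A.indicator 1 ω - v ω| := by
    by_cases hω : ω ∈ A
    · calc |u ω * v ω - A.indicator 1 ω| = |(1 - u ω) + u ω * (1 - v ω)| := by
            rw [abs_sub_comm]; simp only [Set.indicator_of_mem hω, Pi.one_apply]; ring_nf
        _ ≤ |1 - u ω| + |u ω| * |1 - v ω| := (abs_add_le _ _).trans_eq (by rw [abs_mul])
        _ ≤ |1 - u ω| + |1 - v ω| := by
            gcongr; exact mul_le_of_le_one_left (abs_nonneg _) (hu₁ ω)
        _ = _ := by simp [hω]
    · simpa [hω, abs_mul] using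
        (mul_le_of_le_one_left (abs_nonneg (v ω)) (hu₁ ω)).trans
          (le_add_of_nonneg_left (abs_nonneg (u ω)))
  have hAu := (hAint.sub huint).abs
  have hAv := (hAint.sub hvint).abs
  calc |∫ ω, u ω * v ω ∂P - P.real A| = |∫ ω, (u ω * v ω - A.indicator 1 ω) ∂P| := by
        rw [← integral_indicator_one hA, integral_sub huv hAint]
    _ ≤ ∫ ω, |u ω * v ω - A.indicator 1 ω| ∂P := abs_integral_le_integral_abs
    _ ≤ ∫ ω, (|A.indicator 1 ω - u ω| + |A.indicator 1 ω - v ω|) ∂P :=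
        integral_mono (huv.sub hAint).abs (hAu.add hAv) hpointwise
    _ = _ := integral_add hAu hAv

theorem abs_measureReal_sq_sub_integral_sq_le [IsProbabilityMeasure P] {A : Set Ω}
    (hA : MeasurableSet A) {u : Ω → ℝ} (hu : AEStronglyMeasurable u P) (hu₁ : ∀ ω, |u ω| ≤ 1) :
    |P.real A ^ 2 - (∫ ω, u ω ∂P) ^ 2| ≤ 2 * ∫ ω, |A.indicator 1 ω - u ω| ∂P := by
  have hAint : Integrable (A.indicator (1 : Ω → ℝ)) P := (integrable_const (1 : ℝ)).indicator hA
  have huint : Integrable u P := .of_bound hu 1 (.of_forall hu₁)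
  have hsub : |P.real A - ∫ ω, u ω ∂P| ≤ ∫ ω, |A.indicator 1 ω - u ω| ∂P := by
    rw [← integral_indicator_one hA, ← integral_sub hAint huint]
    exact abs_integral_le_integral_abs
  have hmean : |∫ ω, u ω ∂P| ≤ 1 := by
    simpa using norm_integral_le_of_norm_le_const (μ := P) (f := u) (.of_forall hu₁)
  have hadd : |P.real A + ∫ ω, u ω ∂P| ≤ 2 := by
    refine (abs_add_le _ _).trans ?_
    rw [abs_of_nonneg measureReal_nonneg]
    linarith [measureReal_le_one (μ := P) (s := A)]
  rw [sq_sub_sq, abs_mul]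
  gcongr

theorem measureReal_eq_zero_or_one_of_mixing_approx [IsProbabilityMeasure P] {A : Set Ω}
    (hA : MeasurableSet A)
    (h : ∀ ε > 0, ∃ (u : Ω → ℝ) (v : ℕ → Ω → ℝ), AEStronglyMeasurable u P ∧
      (∀ n, AEStronglyMeasurable (v n) P) ∧ (∀ ω, |u ω| ≤ 1) ∧ (∀ n ω, |v n ω| ≤ 1) ∧
      ∫ ω, |A.indicator 1 ω - u ω| ∂P ≤ ε ∧ (∀ n, ∫ ω, |A.indicator 1 ω - v n ω| ∂P ≤ ε) ∧
      Tendsto (fun n ↦ ∫ ω, u ω * v n ω ∂P) atTop (𝓝 ((∫ ω, u ω ∂P) ^ 2))) :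
    P.real A = 0 ∨ P.real A = 1 := by
  have hbound : ∀ ε > 0, |P.real A ^ 2 - P.real A| ≤ 4 * ε := by
    intro ε hε
    obtain ⟨u, v, hu, hv, hu₁, hv₁, hAu, hAv, hmix⟩ := h ε hε
    have hlim : |(∫ ω, u ω ∂P) ^ 2 - P.real A| ≤ ε + ε :=
      le_of_tendsto' (hmix.sub_const _).abs fun n ↦
        (abs_integral_mul_sub_measureReal_le hA hu (hv n) hu₁ (hv₁ n)).trans
          (add_le_add hAu (hAv n))
    linarith [abs_sub_le (P.real A ^ 2) ((∫ ω, u ω ∂P) ^ 2) (P.real A),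
      abs_measureReal_sq_sub_integral_sq_le hA hu hu₁]
  have hidem : P.real A ^ 2 - P.real A = 0 := by
    refine abs_nonpos_iff.1 (le_of_forall_pos_le_add fun ε hε ↦ ?_)
    linarith [hbound (ε / 4) (by positivity)]
  have hfactor : P.real A * (P.real A - 1) = 0 := by linarith
  exact (mul_eq_zero.1 hfactor).imp_right sub_eq_zero.1

theorem IsStationaryProcess.map_shift_eq [IsFiniteMeasure P] {X : ℝ → Ω → ℝ}
    (hX : IsStationaryProcess X P) (hmeas : ∀ t, Measurable (X t)) (h : ℝ) :
    P.map (fun ω t ↦ X (t + h) ω) = P.map fun ω t ↦ X t ω :=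
  (map_eq_iff_forall_finset_map_restrict_eq
    (measurable_pi_lambda _ fun _ ↦ hmeas _).aemeasurable
    (measurable_pi_lambda _ hmeas).aemeasurable).2 fun I ↦ (hX h I).map_eq

theorem IsStationaryProcess.integral_comp_shift [IsFiniteMeasure P] {X : ℝ → Ω → ℝ}
    (hX : IsStationaryProcess X P) (hmeas : ∀ t, Measurable (X t)) {g : (ℝ → ℝ) → ℝ}
    (hg : Measurable g) (h : ℝ) :
    ∫ ω, g (fun t ↦ X (t + h) ω) ∂P = ∫ x, g x ∂P.map fun ω t ↦ X t ω := by
  rw [← hX.map_shift_eq hmeas h, integral_map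
    (measurable_pi_lambda _ fun _ ↦ hmeas _).aemeasurable hg.aestronglyMeasurable]

namespace IsCenteredGaussianProcess

variable {X : ℝ → Ω → ℝ} {r : ℝ → ℝ}

theorem tendsto_integral_mul_shift (hX : IsCenteredGaussianProcess X P)
    (hr : ∀ t s, ∫ ω, X t ω * X s ω ∂P = r (t - s)) (hr₀ : Tendsto r atTop (𝓝 0)) (I : Finset ℝ)
    {f : (I → ℝ) → ℝ} (hf : Continuous f) {C : ℝ} (hfC : ∀ x, |f x| ≤ C) :
    Tendsto (fun n : ℕ ↦ ∫ ω, f (fun i ↦ X i ω) * f (fun i ↦ X (i + n) ω) ∂P) atTop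
      (𝓝 ((∫ ω, f (fun i ↦ X i ω) ∂P) ^ 2)) := by
  have := hX.gaussian.isProbabilityMeasure
  refine tendsto_integral_mul_of_cross_covariance
    (X := fun i : I ↦ X i) (Y := fun (n : ℕ) (i : I) ↦ X (i + n)) (fun n ↦ ?_)
    (fun n i j ↦ ?_) (fun i j ↦ ?_) hf hfC
  · convert! hX.comp_right (Sum.elim (fun i : I ↦ (i : ℝ)) fun i : I ↦ (i : ℝ) + n) using 1
    ext k
    rcases k with k | k <;> rfl
  · rw [hr, hr, add_sub_add_right_eq_sub]
  · have hcross (n : ℕ) : ∫ ω, X i ω * X (j + n) ω ∂P = r (n + (j - i)) := by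
      simp_rw [mul_comm (X i _), hr]
      ring_nf
    simp_rw [hcross]
    exact hr₀.comp (tendsto_atTop_add_const_right atTop ((j : ℝ) - i) tendsto_natCast_atTop_atTop)

theorem isErgodicProcess (hX : IsCenteredGaussianProcess X P) (hmeas : ∀ t, Measurable (X t))
    (hr : ∀ t s, ∫ ω, X t ω * X s ω ∂P = r (t - s)) (hr₀ : Tendsto r atTop (𝓝 0)) :
    IsErgodicProcess X P := by
  intro A hA hinv
  have := hX.gaussian.isProbabilityMeasure
  have hpath (h : ℝ) : Measurable fun ω t ↦ X (t + h) ω := measurable_pi_lambda _ fun _ ↦ hmeas _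
  have hpath₀ : Measurable fun ω t ↦ X t ω := measurable_pi_lambda _ hmeas
  set E : Set Ω := {ω | (fun t ↦ X t ω) ∈ A}
  have hE : MeasurableSet E := hpath₀ hA
  have hzero_one : P.real E = 0 ∨ P.real E = 1 := by
    refine measureReal_eq_zero_or_one_of_mixing_approx hE fun ε hε ↦ ?_
    have := Measure.isProbabilityMeasure_map (μ := P) hpath₀.aemeasurable
    obtain ⟨I, f, hf, hf₁, hfA⟩ :=
      exists_continuous_restrict_integral_abs_indicator_sub_le (P.map fun ω t ↦ X t ω) hA hε
    have hcylinder : Measurable fun x : ℝ → ℝ ↦ f (I.restrict x) :=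
      hf.measurable.comp (Finset.measurable_restrict _)
    have hdist (h : ℝ) : ∫ ω, |E.indicator 1 ω - f (fun i ↦ X (i + h) ω)| ∂P ≤ ε := by
      refine le_of_eq_of_le ((integral_congr_ae ?_).trans
        ((hX.isStationaryProcess hr).integral_comp_shift hmeas
          ((measurable_one.indicator hA).sub hcylinder).abs h)) hfA
      filter_upwards [hinv h] with ω hω
      have hindicator : E.indicator (1 : Ω → ℝ) ω = A.indicator 1 fun t ↦ X (t + h) ω :=
        Set.indicator_eq_indicator hω.symm rfl
      exact congrArg (|· - f fun i ↦ X (i + h) ω|) hindicator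
    exact ⟨fun ω ↦ f fun i ↦ X i ω, fun n ω ↦ f fun i ↦ X (i + n) ω,
      (hcylinder.comp hpath₀).aestronglyMeasurable,
      fun n ↦ (hcylinder.comp (hpath n)).aestronglyMeasurable, fun _ ↦ hf₁ _, fun _ _ ↦ hf₁ _,
      by simpa using hdist 0, fun n ↦ hdist n, hX.tendsto_integral_mul_shift hr hr₀ I hf hf₁⟩
  rcases hzero_one with h | h
  · exact Or.inr (measure_eq_zero_iff_ae_notMem.1 ((measureReal_eq_zero_iff (by finiteness)).1 h))
  · refine Or.inl ((mem_ae_iff_prob_eq_one hE).2 ?_)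
    rw [← ofReal_measureReal, h, ENNReal.ofReal_one]

end IsCenteredGaussianProcess

theorem IsErgodicProcess.congr {X Y : ℝ → Ω → ℝ} (hX : IsErgodicProcess X P)
    (h : ∀ᵐ ω ∂P, ∀ t, X t ω = Y t ω) : IsErgodicProcess Y P := by
  have hpath : ∀ᵐ ω ∂P, (fun t ↦ X t ω) = fun t ↦ Y t ω := h.mono fun ω hω ↦ funext hω
  intro A hA hinv
  refine (hX A hA fun s ↦ ?_).imp (fun hA ↦ ?_) fun hA ↦ ?_
  · filter_upwards [hinv s, h, hpath] with ω hω hXY hω₀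
    simpa only [hXY, hω₀] using hω
  · filter_upwards [hA, hpath] with ω hω hω₀
    rwa [← hω₀]
  · filter_upwards [hA, hpath] with ω hω hω₀
    rwa [← hω₀]

end Ergodicity

theorem IsCenteredGaussianProcess.abs_covariance_le {Ω : Type*} [MeasurableSpace Ω] {P : Measure Ω}
    {X : ℝ → Ω → ℝ} {r : ℝ → ℝ} (hX : IsCenteredGaussianProcess X P)
    (hr : ∀ t s, ∫ ω, X t ω * X s ω ∂P = r (t - s)) (t : ℝ) : |r t| ≤ r 0 := by
  have hamgm (ω : Ω) : |X t ω * X 0 ω| ≤ 1 / 2 * (X t ω * X t ω + X 0 ω * X 0 ω) := by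
    rw [abs_mul, ← abs_mul_abs_self (X t ω), ← abs_mul_abs_self (X 0 ω)]
    linarith [sq_nonneg (|X t ω| - |X 0 ω|)]
  calc |r t| = |∫ ω, X t ω * X 0 ω ∂P| := by rw [hr, sub_zero]
    _ ≤ ∫ ω, |X t ω * X 0 ω| ∂P := abs_integral_le_integral_abs
    _ ≤ ∫ ω, 1 / 2 * (X t ω * X t ω + X 0 ω * X 0 ω) ∂P :=
      integral_mono (hX.integrable_mul t 0).abs
        (((hX.integrable_mul t t).add (hX.integrable_mul 0 0)).const_mul _) hamgm
    _ = r 0 := by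
      rw [integral_const_mul, integral_add (hX.integrable_mul t t) (hX.integrable_mul 0 0), hr, hr,
        sub_self, sub_self]
      ring

theorem exp_neg_mul_le_rpow {θ a u : ℝ} (hθ : 0 < θ) (ha : -2 ≤ a) (hu : 1 ≤ u) :
    Real.exp (-θ * u) ≤ 2 / θ ^ 2 * u ^ a := by
  have hquad : (θ * u) ^ 2 / 2 ≤ Real.exp (θ * u) := by
    simpa using Real.pow_div_factorial_le_exp (θ * u) (by positivity) 2
  calc Real.exp (-θ * u) = (Real.exp (θ * u))⁻¹ := by rw [← Real.exp_neg, neg_mul]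
    _ ≤ ((θ * u) ^ 2 / 2)⁻¹ := inv_anti₀ (by positivity) hquad
    _ = 2 / θ ^ 2 * u ^ (-2 : ℝ) := by
        rw [Real.rpow_neg (by linarith), Real.rpow_two]
        field_simp
    _ ≤ 2 / θ ^ 2 * u ^ a := by gcongr

theorem fouCov_zero_pos {H θ : ℝ} (hH : 0 < H) (hθ : 0 < θ) : 0 < fouCov H θ 0 := by
  have := Real.Gamma_pos_of_pos (mul_pos two_pos hH)
  rw [fouCov_zero hH hθ]
  positivity

theorem tendsto_fouCov_div_asymptotic {H θ : ℝ} (hH₀ : 0 < H) (hH₁ : H < 1) (hH : H ≠ 1 / 2)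
    (hθ : 0 < θ) :
    Tendsto (fun t ↦ fouCov H θ t / (H * (2 * H - 1) * t ^ (2 * H - 2) / θ ^ 2)) atTop (𝓝 1) := by
  have hne : H * (2 * H - 1) / θ ^ 2 ≠ 0 := by
    have : 2 * H - 1 ≠ 0 := fun h ↦ hH (by linarith)
    positivity
  have h := (tendsto_fouCov_div_rpow hH₀ hH₁ hθ).div_const (H * (2 * H - 1) / θ ^ 2)
  rw [div_self hne] at h
  refine h.congr fun t ↦ ?_
  rw [div_div, mul_div_assoc', mul_comm (t ^ _)]

namespace IsFractionalBrownianMotion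

section

variable {Ω : Type*} [MeasurableSpace Ω] {P : Measure Ω} {H θ : ℝ} {B : ℝ → Ω → ℝ}

theorem ae_exists_rsIntegral (hB : IsFractionalBrownianMotion H B P) (hH : 0 < H) (hθ : 0 < θ) :
    ∀ᵐ ω ∂P,
      (∀ t ≥ 0, ∃ I, HasRSIntegral (fun s ↦ Real.exp (θ * s)) (fun s ↦ B s ω) 0 t I) ∧
      ∀ t, ∃ I, HasRSIntegralIic (fun s ↦ Real.exp (-θ * (t - s))) (fun s ↦ B s ω) t I := by
  filter_upwards [hB.ae_isSubexponentialPath hH] with ω hω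
  refine ⟨fun t ht ↦ ?_, fun t ↦ ⟨_, hω.hasRSIntegralIic_exp_sub hθ t t⟩⟩
  have h := hasRSIntegral_exp_sub θ 0 ht hω.continuous.continuousOn
  simp only [zero_sub, neg_mul_neg] at h
  exact ⟨_, h⟩

theorem fouX_ae_eq (hB : IsFractionalBrownianMotion H B P) (hH : 0 < H) (hθ : 0 < θ) {t : ℝ}
    (ht : 0 ≤ t) :
    fouX θ B t =ᵐ[P] fun ω ↦ fouZ θ B t ω - Real.exp (-θ * t) * fouZ θ B 0 ω := by
  filter_upwards [hB.ae_isSubexponentialPath hH] with ω hω using hω.exp_mul_rsIntegral_eq hθ ht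

theorem exists_fouZ_version (hB : IsFractionalBrownianMotion H B P) (hH : 0 < H) (hθ : 0 < θ) :
    ∃ Z : ℝ → Ω → ℝ, IsCenteredGaussianProcess Z P ∧ (∀ t, Measurable (Z t)) ∧
      (∀ t s, ∫ ω, Z t ω * Z s ω ∂P = fouCov H θ (t - s)) ∧
      ∀ᵐ ω ∂P, ∀ t, Z t ω = fouZ θ B t ω := by
  obtain ⟨B', hB', hmeas, hpath, hae⟩ := hB.exists_regular_version hH
  refine ⟨fouZ θ B',
    isCenteredGaussianProcess_fouZ_of_isSubexponentialPath hB'.isCenteredGaussianProcess hpath hθ,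
    measurable_fouZ hmeas hpath hθ, hB'.integral_fouZ_mul_fouZ_of_regular hH hmeas hpath hθ, ?_⟩
  filter_upwards [hae] with ω hω t
  simp_rw [fouZ, hω]

theorem isCenteredGaussianProcess_fouZ (hB : IsFractionalBrownianMotion H B P) (hH : 0 < H)
    (hθ : 0 < θ) : IsCenteredGaussianProcess (fouZ θ B) P := by
  obtain ⟨Z, hZ, -, -, hae⟩ := hB.exists_fouZ_version hH hθ
  exact hZ.congr fun t ↦ hae.mono fun ω hω ↦ hω t

theorem integral_fouZ_mul_fouZ (hB : IsFractionalBrownianMotion H B P) (hH : 0 < H) (hθ : 0 < θ)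
    (t s : ℝ) : ∫ ω, fouZ θ B t ω * fouZ θ B s ω ∂P = fouCov H θ (t - s) := by
  obtain ⟨Z, -, -, hcov, hae⟩ := hB.exists_fouZ_version hH hθ
  rw [← hcov]
  exact integral_congr_ae (hae.mono fun ω hω ↦ by simp only [hω])

theorem isErgodicProcess_fouZ (hB : IsFractionalBrownianMotion H B P) (hH₀ : 0 < H) (hH₁ : H < 1)
    (hθ : 0 < θ) : IsErgodicProcess (fouZ θ B) P := by
  obtain ⟨Z, hZ, hmeas, hcov, hae⟩ := hB.exists_fouZ_version hH₀ hθ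
  exact (hZ.isErgodicProcess hmeas hcov (tendsto_fouCov_atTop hH₀ hH₁ hθ)).congr hae

theorem abs_fouCov_le (hB : IsFractionalBrownianMotion H B P) (hH : 0 < H) (hθ : 0 < θ) (t : ℝ) :
    |fouCov H θ t| ≤ fouCov H θ 0 :=
  (hB.isCenteredGaussianProcess_fouZ hH hθ).abs_covariance_le (hB.integral_fouZ_mul_fouZ hH hθ) t

theorem isCenteredGaussianProcess_fouX (hB : IsFractionalBrownianMotion H B P) (hH : 0 < H)
    (hθ : 0 < θ) : IsCenteredGaussianProcess (fun t : Set.Ici (0 : ℝ) ↦ fouX θ B t) P := by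
  have hdiff : IsCenteredGaussianProcess
      (fun (t : Set.Ici (0 : ℝ)) ω ↦ fouZ θ B t ω - Real.exp (-θ * t) * fouZ θ B 0 ω) P := by
    refine (hB.isCenteredGaussianProcess_fouZ hH hθ).of_forall_clm fun t ↦ ⟨{(t : ℝ), 0},
      ContinuousLinearMap.proj ⟨t, by simp⟩ -
        Real.exp (-θ * t) • ContinuousLinearMap.proj ⟨0, by simp⟩, fun ω ↦ ?_⟩
    simp
  exact hdiff.congr fun t ↦ (hB.fouX_ae_eq hH hθ t.2).symm

theorem integral_fouX_mul_fouX (hB : IsFractionalBrownianMotion H B P) (hH : 0 < H) (hθ : 0 < θ)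
    {t s : ℝ} (ht : 0 ≤ t) (hs : 0 ≤ s) :
    ∫ ω, fouX θ B t ω * fouX θ B s ω ∂P =
      fouCov H θ (t - s) - Real.exp (-θ * s) * fouCov H θ t - Real.exp (-θ * t) * fouCov H θ s +
        Real.exp (-θ * t) * Real.exp (-θ * s) * fouCov H θ 0 := by
  have hint (c a b : ℝ) : Integrable (fun ω ↦ c * (fouZ θ B a ω * fouZ θ B b ω)) P :=
    ((hB.isCenteredGaussianProcess_fouZ hH hθ).integrable_mul a b).const_mul c
  have hint_sub (c a b d a' b' : ℝ) : Integrable (fun ω ↦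
      c * (fouZ θ B a ω * fouZ θ B b ω) - d * (fouZ θ B a' ω * fouZ θ B b' ω)) P :=
    (hint c a b).sub (hint d a' b')
  have hexpand : (fun ω ↦ fouX θ B t ω * fouX θ B s ω) =ᵐ[P] fun ω ↦
      (1 * (fouZ θ B t ω * fouZ θ B s ω) - Real.exp (-θ * s) * (fouZ θ B t ω * fouZ θ B 0 ω)) -
        (Real.exp (-θ * t) * (fouZ θ B s ω * fouZ θ B 0 ω) -
          Real.exp (-θ * t) * Real.exp (-θ * s) * (fouZ θ B 0 ω * fouZ θ B 0 ω)) := by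
    filter_upwards [hB.fouX_ae_eq hH hθ ht, hB.fouX_ae_eq hH hθ hs] with ω hωt hωs
    rw [hωt, hωs]
    ring
  rw [integral_congr_ae hexpand, integral_sub (hint_sub ..) (hint_sub ..),
    integral_sub (hint ..) (hint ..), integral_sub (hint ..) (hint ..)]
  simp only [integral_const_mul, hB.integral_fouZ_mul_fouZ hH hθ, sub_zero, one_mul]
  ring

theorem abs_integral_fouX_sq_sub_le (hB : IsFractionalBrownianMotion H B P) (hH : 0 < H)
    (hθ : 0 < θ) {t : ℝ} (ht : 0 ≤ t) :
    |∫ ω, fouX θ B t ω ^ 2 ∂P - fouCov H θ 0| ≤ 3 * fouCov H θ 0 * Real.exp (-θ * t) := by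
  simp_rw [sq, hB.integral_fouX_mul_fouX hH hθ ht ht, sub_self]
  have hV := (fouCov_zero_pos hH hθ).le
  set e := Real.exp (-θ * t)
  have he₀ : 0 < e := Real.exp_pos _
  have he₁ : e ≤ 1 := Real.exp_le_one_iff.2 (by nlinarith)
  have hcross : |e * fouCov H θ t| ≤ e * fouCov H θ 0 := by
    rw [abs_mul, abs_of_pos he₀]
    gcongr
    exact hB.abs_fouCov_le hH hθ t
  have hsq : e * e * fouCov H θ 0 ≤ e * fouCov H θ 0 := by
    gcongr
    exact mul_le_of_le_one_left he₀.le he₁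
  have hsq₀ : 0 ≤ e * e * fouCov H θ 0 := by positivity
  obtain ⟨hcross_lower, hcross_upper⟩ := abs_le.1 hcross
  rw [abs_le]
  constructor <;> linarith

theorem abs_integral_fouX_sq_pow_sub_le (hB : IsFractionalBrownianMotion H B P) (hH : 0 < H)
    (hθ : 0 < θ) {t : ℝ} (ht : 0 ≤ t) (k : ℕ) :
    |(∫ ω, fouX θ B t ω ^ 2 ∂P) ^ k - fouCov H θ 0 ^ k| ≤
      3 * fouCov H θ 0 * k * (4 * fouCov H θ 0) ^ (k - 1) * Real.exp (-θ * t) := by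
  have hV := (fouCov_zero_pos hH hθ).le
  have hdist := hB.abs_integral_fouX_sq_sub_le hH hθ ht
  have hexp : Real.exp (-θ * t) ≤ 1 := Real.exp_le_one_iff.2 (by nlinarith)
  have hmax : max |∫ ω, fouX θ B t ω ^ 2 ∂P| |fouCov H θ 0| ≤ 4 * fouCov H θ 0 := by
    rw [abs_of_nonneg hV, abs_of_nonneg (integral_nonneg fun ω ↦ sq_nonneg _)]
    exact max_le (by nlinarith [(abs_le.1 hdist).2]) (by linarith)
  calc _ ≤ |∫ ω, fouX θ B t ω ^ 2 ∂P - fouCov H θ 0| * k *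
        max |∫ ω, fouX θ B t ω ^ 2 ∂P| |fouCov H θ 0| ^ (k - 1) := abs_pow_sub_pow_le _ _ _
    _ ≤ 3 * fouCov H θ 0 * Real.exp (-θ * t) * k * (4 * fouCov H θ 0) ^ (k - 1) := by gcongr
    _ = _ := by ring

theorem integral_fouZ_pow_of_even (hB : IsFractionalBrownianMotion H B P) (hH : 0 < H)
    (hθ : 0 < θ) (t : ℝ) {p : ℕ} (hp : Even p) :
    ∫ ω, fouZ θ B t ω ^ p ∂P =
      (p ! : ℝ) / (2 ^ (p / 2) * ((p / 2)! : ℝ)) * fouCov H θ 0 ^ (p / 2) := by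
  have hZ := hB.isCenteredGaussianProcess_fouZ hH hθ
  rw [integral_pow_of_centered_of_even (hZ.gaussian.hasGaussianLaw_eval t) (hZ.centered t) hp]
  simp_rw [sq, hB.integral_fouZ_mul_fouZ hH hθ, sub_self]

theorem integral_fouX_mul_fouX_le (hB : IsFractionalBrownianMotion H B P) (hH : 0 < H)
    (hθ : 0 < θ) {t s : ℝ} (ht : 0 ≤ t) (hs : 0 ≤ s) :
    ∫ ω, fouX θ B t ω * fouX θ B s ω ∂P ≤
      |fouCov H θ (t - s)| + |fouCov H θ t| + 2 * fouCov H θ 0 * Real.exp (-θ * t) := by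
  rw [hB.integral_fouX_mul_fouX hH hθ ht hs]
  have hV := (fouCov_zero_pos hH hθ).le
  set e := Real.exp (-θ * s)
  have he₀ : 0 < e := Real.exp_pos _
  have he₁ : e ≤ 1 := Real.exp_le_one_iff.2 (by nlinarith)
  have hdecay : -(e * fouCov H θ t) ≤ |fouCov H θ t| := by
    rw [← mul_neg]
    exact (mul_le_mul_of_nonneg_left (neg_le_abs _) he₀.le).trans
      (mul_le_of_le_one_left (abs_nonneg _) he₁)
  have hcross : -(Real.exp (-θ * t) * fouCov H θ s) ≤ Real.exp (-θ * t) * fouCov H θ 0 := by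
    rw [← mul_neg]
    gcongr
    exact (neg_le_abs _).trans (hB.abs_fouCov_le hH hθ s)
  have hlast : Real.exp (-θ * t) * e * fouCov H θ 0 ≤ Real.exp (-θ * t) * fouCov H θ 0 := by
    gcongr
    exact mul_le_of_le_one_right (Real.exp_pos _).le he₁
  linarith [le_abs_self (fouCov H θ (t - s))]

theorem integral_fouX_mul_fouX_le_exp (hB : IsFractionalBrownianMotion (1 / 2) B P) (hθ : 0 < θ)
    {t s : ℝ} (ht : 0 ≤ t) (hs : 0 ≤ s) :
    ∫ ω, fouX θ B t ω * fouX θ B s ω ∂P ≤ 1 / (2 * θ) * Real.exp (-θ * |t - s|) := by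
  have hcov : ∫ ω, fouX θ B t ω * fouX θ B s ω ∂P =
      1 / (2 * θ) * (Real.exp (-θ * |t - s|) - Real.exp (-θ * t) * Real.exp (-θ * s)) := by
    rw [hB.integral_fouX_mul_fouX one_half_pos hθ ht hs, ← fouCov_abs _ _ (t - s),
      fouCov_half hθ (abs_nonneg _), fouCov_half hθ ht, fouCov_half hθ hs, fouCov_half hθ le_rfl,
      mul_zero, Real.exp_zero]
    ring
  rw [hcov]
  gcongr
  exact sub_le_self _ (by positivity)

end

theorem exists_abs_integral_fouX_pow_sub_le {H θ : ℝ} (hH : 0 < H) (hθ : 0 < θ) (p : ℕ) :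
    ∃ C > 0, ∀ {Ω : Type*} [MeasurableSpace Ω] {P : Measure Ω} {B : ℝ → Ω → ℝ},
      IsFractionalBrownianMotion H B P → Even p → ∀ t ≥ 0,
        |∫ ω, fouX θ B t ω ^ p ∂P - ∫ ω, fouZ θ B 0 ω ^ p ∂P| ≤ C * Real.exp (-θ * t) := by
  have hV := fouCov_zero_pos hH hθ
  refine ⟨(p ! : ℝ) / (2 ^ (p / 2) * ((p / 2)! : ℝ)) *
    (3 * fouCov H θ 0 * (p / 2 : ℕ) * (4 * fouCov H θ 0) ^ (p / 2 - 1)) + 1, by positivity,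
    fun {Ω} _ {P B} hB hp t ht ↦ ?_⟩
  have hX := hB.isCenteredGaussianProcess_fouX hH hθ
  rw [integral_pow_of_centered_of_even (hX.gaussian.hasGaussianLaw_eval ⟨t, ht⟩)
    (hX.centered ⟨t, ht⟩) hp, hB.integral_fouZ_pow_of_even hH hθ 0 hp, ← mul_sub, abs_mul,
    abs_of_nonneg (by positivity), add_mul, one_mul, mul_assoc (_ / _)]
  refine le_add_of_le_of_nonneg ?_ (Real.exp_pos _).le
  gcongr
  exact hB.abs_integral_fouX_sq_pow_sub_le hH hθ ht _

theorem exists_integral_fouX_mul_fouX_le_rpow {H θ : ℝ} (hH₀ : 0 < H) (hH₁ : H < 1) (hθ : 0 < θ) :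
    ∃ K, ∀ {Ω : Type*} [MeasurableSpace Ω] {P : Measure Ω} {B : ℝ → Ω → ℝ},
      IsFractionalBrownianMotion H B P → ∀ t ≥ 0, ∀ s ≥ 0, 1 ≤ |t - s| →
        ∫ ω, fouX θ B t ω * fouX θ B s ω ∂P ≤ K * |t - s| ^ (2 * H - 2) := by
  obtain ⟨K, hK₀, hK⟩ := exists_abs_fouCov_le hH₀ hH₁ hθ
  refine ⟨K + K + 2 * fouCov H θ 0 * (2 / θ ^ 2), fun {Ω} _ {P B} hB t ht s hs hts ↦ ?_⟩
  wlog hst : s ≤ t generalizing t s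
  · rw [abs_sub_comm] at hts ⊢
    simp_rw [mul_comm (fouX θ B t _)]
    exact this s hs t ht hts (le_of_not_ge hst)
  rw [abs_of_nonneg (sub_nonneg.2 hst)] at hts ⊢
  have hV := (fouCov_zero_pos hH₀ hθ).le
  have hle : t - s ≤ t := sub_le_self t hs
  have hrpow : t ^ (2 * H - 2) ≤ (t - s) ^ (2 * H - 2) :=
    Real.rpow_le_rpow_of_nonpos (by linarith) hle (by linarith)
  have hexp : Real.exp (-θ * t) ≤ 2 / θ ^ 2 * (t - s) ^ (2 * H - 2) :=
    (exp_neg_mul_le_rpow (a := 2 * H - 2) hθ (by linarith) (hts.trans hle)).trans (by gcongr)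
  calc ∫ ω, fouX θ B t ω * fouX θ B s ω ∂P
      ≤ |fouCov H θ (t - s)| + |fouCov H θ t| + 2 * fouCov H θ 0 * Real.exp (-θ * t) :=
        hB.integral_fouX_mul_fouX_le hH₀ hθ ht hs
    _ ≤ K * (t - s) ^ (2 * H - 2) + K * (t - s) ^ (2 * H - 2) +
        2 * fouCov H θ 0 * (2 / θ ^ 2 * (t - s) ^ (2 * H - 2)) := by
      gcongr
      · exact hK _ (by linarith)
      · exact (hK t (by linarith)).trans (by gcongr)
    _ = _ := by ring

end IsFractionalBrownianMotion

theorem theorem3p2 (H θ : ℝ) (hH₀ : 0 < H) (hH₁ : H < 1) (hθ : 0 < θ) :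
    -- the constants of (ii) and (iv): they depend only on `θ`, `H` and (in (ii)) on `p`
    ∃ (C : ℕ → ℝ) (K : ℝ), (∀ p, 0 < C p) ∧ 0 < K ∧
    ∀ {Ω : Type*} [MeasurableSpace Ω] (P : Measure Ω) [IsProbabilityMeasure P] (B : ℝ → Ω → ℝ),
      IsFractionalBrownianMotion H B P →
      -- the pathwise integrals exist, and the two processes have moments of all orders
      (∀ᵐ ω ∂P,
        (∀ t ≥ 0, ∃ I, HasRSIntegral (fun s ↦ Real.exp (θ * s)) (fun s ↦ B s ω) 0 t I) ∧
        (∀ t, ∃ I, HasRSIntegralIic (fun s ↦ Real.exp (-θ * (t - s))) (fun s ↦ B s ω) t I)) ∧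
      (∀ p : ℕ, (∀ t ≥ 0, MemLp (fouX θ B t) p P) ∧ ∀ t, MemLp (fouZ θ B t) p P) ∧
      -- (i)
      (IsGaussianProcess (fouZ θ B) P ∧ IsStationaryProcess (fouZ θ B) P ∧
        IsErgodicProcess (fouZ θ B) P) ∧
      -- (ii)
      (∀ p : ℕ, 1 ≤ p →
        (Even p →
          (∀ t ≥ 0, |∫ ω, fouX θ B t ω ^ p ∂P - ∫ ω, fouZ θ B 0 ω ^ p ∂P|
            ≤ C p * Real.exp (-θ * t)) ∧
          ∫ ω, fouZ θ B 0 ω ^ p ∂P = (p ! : ℝ) / (2 ^ (p / 2) * ((p / 2)! : ℝ)) *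
            (H * Real.Gamma (2 * H) / θ ^ (2 * H)) ^ (p / 2)) ∧
        (Odd p →
          (∀ t ≥ 0, ∫ ω, fouX θ B t ω ^ p ∂P = 0) ∧ ∫ ω, fouZ θ B 0 ω ^ p ∂P = 0)) ∧
      -- (iii)
      (H ≠ 1 / 2 → Tendsto (fun t ↦ (∫ ω, fouZ θ B t ω * fouZ θ B 0 ω ∂P) /
        (H * (2 * H - 1) * t ^ (2 * H - 2) / θ ^ 2)) atTop (𝓝 1)) ∧
      (H = 1 / 2 → ∀ t ≥ 0,
        ∫ ω, fouZ θ B t ω * fouZ θ B 0 ω ∂P = Real.exp (-θ * t) / (2 * θ)) ∧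
      -- (iv)
      (H ≠ 1 / 2 → ∀ t ≥ 0, ∀ s ≥ 0, 2 < |t - s| →
        ∫ ω, fouX θ B t ω * fouX θ B s ω ∂P ≤ K * |t - s| ^ (2 * H - 2)) ∧
      (H = 1 / 2 → ∀ t ≥ 0, ∀ s ≥ 0, 2 < |t - s| →
        ∫ ω, fouX θ B t ω * fouX θ B s ω ∂P ≤ K * Real.exp (-θ * |t - s|)) := by
  choose C hC₀ hC using IsFractionalBrownianMotion.exists_abs_integral_fouX_pow_sub_le hH₀ hθ
  obtain ⟨K, hK⟩ := IsFractionalBrownianMotion.exists_integral_fouX_mul_fouX_le_rpow hH₀ hH₁ hθ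
  refine ⟨C, max K (1 / (2 * θ)), hC₀, lt_max_of_lt_right (by positivity), fun {Ω} _ P _ B hB ↦ ?_⟩
  have hZ := hB.isCenteredGaussianProcess_fouZ hH₀ hθ
  have hX := hB.isCenteredGaussianProcess_fouX hH₀ hθ
  have hcov := hB.integral_fouZ_mul_fouZ hH₀ hθ
  have hZlaw := hZ.gaussian.hasGaussianLaw_eval
  have hXlaw (t : ℝ) (ht : 0 ≤ t) := hX.gaussian.hasGaussianLaw_eval ⟨t, ht⟩
  have htop (p : ℕ) := ENNReal.natCast_ne_top p
  refine ⟨hB.ae_exists_rsIntegral hH₀ hθ,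
    fun p ↦ ⟨fun t ht ↦ (hXlaw t ht).memLp (htop p), fun t ↦ (hZlaw t).memLp (htop p)⟩,
    ⟨hZ.gaussian, hZ.isStationaryProcess hcov, hB.isErgodicProcess_fouZ hH₀ hH₁ hθ⟩,
    fun p _ ↦ ⟨fun hp ↦ ⟨hC p hB hp, ?_⟩, fun hp ↦
      ⟨fun t ht ↦ integral_pow_eq_zero_of_centered_of_odd (hXlaw t ht) (hX.centered ⟨t, ht⟩) hp,
        integral_pow_eq_zero_of_centered_of_odd (hZlaw 0) (hZ.centered 0) hp⟩⟩,
    fun hH ↦ ?_, fun hH t ht ↦ ?_, fun _ t ht s hs hts ↦ ?_, fun hH t ht s hs _ ↦ ?_⟩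
  · rw [hB.integral_fouZ_pow_of_even hH₀ hθ 0 hp, fouCov_zero hH₀ hθ]
  · simp_rw [hcov, sub_zero]
    exact tendsto_fouCov_div_asymptotic hH₀ hH₁ hH hθ
  · rw [hcov, sub_zero, hH, fouCov_half hθ ht]
  · exact (hK hB t ht s hs (by linarith)).trans (by gcongr; exact le_max_left ..)
  · subst hH
    exact (hB.integral_fouX_mul_fouX_le_exp hθ ht hs).trans (by gcongr; exact le_max_right ..)
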